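/- Let $q$ be a prime power. An $(n,n-r,\ell)$ MDS array code over $\mathbb F_q$ is an $\mathbb F_q$-subspace $\mathcal C\le(\mathbb F_q^{\ell})^n$ of dimension $(n-r)\ell$ of the form $$\mathcal C=\{(\mathbf c_1,\dots,\mathbf c_n): H_1\mathbf c_1+\cdots+H_n\mathbf c_n=0\},$$ where $H=[H_1\,\cdots\,H_n]$, with blocks $H_i\in\mathbb F_q^{r\ell\times\ell}$, has full row rank $r\ell$, and where for every $I\subseteq\{1,\dots,n\}$ with $|I|=r$ the square matrix $[H_i]_{i\in I}$ is invertible. For $1\le i\le n$, a repair matrix for node $i$ is a matrix $M\in\mathbb F_q^{\ell\times r\ell}$ such that $MH_i$ is invertible; its repair bandwidth is $\mathrm{BW}_i(M)=\sum_{j\ne i}\operatorname{rank}(MH_j)$. Let $\beta_i(\mathcal C)$ be the minimum of $\mathrm{BW}_i(M)$ over all repair matrices $M$ for node $i$ (this does not depend on the choice of the parity-check matrix $H$), let $\beta(\mathcal C)=\max_{1\le i\le n}\beta_i(\mathcal C)$, and let $\beta_{\mathrm{opt}}^{(q,n,r,\ell)}$ be the minimum of $\beta(\mathcal C)$ over all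 $(n,n-r,\ell)$ MDS array codes $\mathcal C$ over $\mathbb F_q$. Proposition. One has $$\beta_{\mathrm{opt}}^{(9,10,2,2)}=11,\qquad \beta_{\mathrm{opt}}^{(8,10,2,2)}=11.$$ In particular, over $\mathbb F_8$ and over $\mathbb F_9$ no $(10,8,2)$ MDS array code $\mathcal C$ has $\beta(\mathcal C)=10$, so the lower bound $\beta(\mathcal C)\ge\lceil(5\cdot10-10)/4\rceil=10$ is not attained. -/

import Mathlib

namespace MDSArray

variable {F : Type*} [Field F] {n r ℓ : ℕ}

/-- The `j`-th block `H_j`, of size `rℓ × ℓ`, of a block matrix `H = [H_1 ⋯ H_n]`.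
The `rℓ` rows are indexed by `Fin r × Fin ℓ`, the `nℓ` columns by `Fin n × Fin ℓ`. -/
def block (H : Matrix (Fin r × Fin ℓ) (Fin n × Fin ℓ) F) (j : Fin n) :
    Matrix (Fin r × Fin ℓ) (Fin ℓ) F :=
  H.submatrix id (fun t => (j, t))

/-- `H` is a block parity-check matrix of `C ≤ (F^ℓ)^n`: it has full row rank `rℓ`, and `C` is
the set of `c = (c_1, …, c_n)` with `H_1 c_1 + ⋯ + H_n c_n = 0`. -/
def IsParityCheck (H : Matrix (Fin r × Fin ℓ) (Fin n × Fin ℓ) F)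
    (C : Submodule F (Fin n → Fin ℓ → F)) : Prop :=
  H.rank = r * ℓ ∧ ∀ c : Fin n → Fin ℓ → F, c ∈ C ↔ ∑ j, (block H j).mulVec (c j) = 0

/-- Every square block matrix `[H_i]_{i ∈ I}` with `|I| = r` is invertible. The subset `I` is given
by an enumeration `e` of its elements; the order of the blocks does not affect invertibility. -/
def HasInvertibleBlocks (H : Matrix (Fin r × Fin ℓ) (Fin n × Fin ℓ) F) : Prop :=
  ∀ e : Fin r ↪ Fin n,
    IsUnit (H.submatrix id (fun p : Fin r × Fin ℓ => (e p.1, p.2)))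

/-- `C` is an `(n, n - r, ℓ)` MDS array code over `F`. -/
def IsMDSArrayCode (r : ℕ) (C : Submodule F (Fin n → Fin ℓ → F)) : Prop :=
  Module.finrank F C = (n - r) * ℓ ∧
    ∃ H : Matrix (Fin r × Fin ℓ) (Fin n × Fin ℓ) F, IsParityCheck H C ∧ HasInvertibleBlocks H

/-- `M` is a repair matrix for node `i`: the `ℓ × ℓ` matrix `M H_i` is invertible. -/
def IsRepairMatrix (H : Matrix (Fin r × Fin ℓ) (Fin n × Fin ℓ) F) (i : Fin n)
    (M : Matrix (Fin ℓ) (Fin r × Fin ℓ) F) : Prop :=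
  IsUnit (M * block H i)

/-- The repair bandwidth `BW_i(M) = ∑_{j ≠ i} rank (M H_j)`. -/
noncomputable def bandwidth (H : Matrix (Fin r × Fin ℓ) (Fin n × Fin ℓ) F) (i : Fin n)
    (M : Matrix (Fin ℓ) (Fin r × Fin ℓ) F) : ℕ :=
  ∑ j ∈ Finset.univ.erase i, (M * block H j).rank

/-- `β_i(C)`: the least repair bandwidth of a repair matrix for node `i`. It does not depend on
the parity-check matrix used, see `nodeBandwidth_eq`. -/
noncomputable def nodeBandwidth (r : ℕ) (C : Submodule F (Fin n → Fin ℓ → F)) (i : Fin n) : ℕ :=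
  sInf {b | ∃ (H : Matrix (Fin r × Fin ℓ) (Fin n × Fin ℓ) F) (M : Matrix (Fin ℓ) (Fin r × Fin ℓ) F),
    IsParityCheck H C ∧ IsRepairMatrix H i M ∧ b = bandwidth H i M}

/-- `β(C) = max_i β_i(C)`. -/
noncomputable def worstBandwidth (r : ℕ) (C : Submodule F (Fin n → Fin ℓ → F)) : ℕ :=
  Finset.univ.sup (nodeBandwidth r C)

/-- `β_opt^{(q,n,r,ℓ)}` for `F` the field with `q` elements: the least worst-case repair bandwidth
of an `(n, n - r, ℓ)` MDS array code over `F`. -/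
noncomputable def optBandwidth (F : Type*) [Field F] (n r ℓ : ℕ) : ℕ :=
  sInf {b | ∃ C : Submodule F (Fin n → Fin ℓ → F), IsMDSArrayCode r C ∧ b = worstBandwidth r C}

lemma sum_block_mulVec (H : Matrix (Fin r × Fin ℓ) (Fin n × Fin ℓ) F) (c : Fin n → Fin ℓ → F) :
    ∑ j, (block H j).mulVec (c j) = H.mulVec (fun p => c p.1 p.2) := by
  ext a
  simp [block, Matrix.mulVec, dotProduct, Fintype.sum_prod_type, Finset.sum_apply]

lemma mul_block (P : Matrix (Fin r × Fin ℓ) (Fin r × Fin ℓ) F)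
    (H : Matrix (Fin r × Fin ℓ) (Fin n × Fin ℓ) F) (j : Fin n) :
    block (P * H) j = P * block H j := by
  ext a b
  simp [block, Matrix.mul_apply]

lemma IsParityCheck.exists_right_inverse {H : Matrix (Fin r × Fin ℓ) (Fin n × Fin ℓ) F}
    {C : Submodule F (Fin n → Fin ℓ → F)} (h : IsParityCheck H C) :
    ∃ R : Matrix (Fin n × Fin ℓ) (Fin r × Fin ℓ) F, H * R = 1 := by
  rw [← Matrix.mulVec_surjective_iff_exists_right_inverse]
  have h1 : LinearMap.range H.mulVecLin = ⊤ := by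
    apply Submodule.eq_top_of_finrank_eq
    have := h.1
    rw [Matrix.rank] at this
    simp [this]
  exact LinearMap.range_eq_top.1 h1

lemma IsParityCheck.exists_eq_mul {H H' : Matrix (Fin r × Fin ℓ) (Fin n × Fin ℓ) F}
    {C : Submodule F (Fin n → Fin ℓ → F)} (h : IsParityCheck H C) (h' : IsParityCheck H' C) :
    ∃ P : Matrix (Fin r × Fin ℓ) (Fin r × Fin ℓ) F, H' = P * H := by
  obtain ⟨R, hR⟩ := h.exists_right_inverse
  have key : ∀ x : Fin n × Fin ℓ → F, H.mulVec x = 0 → H'.mulVec x = 0 := by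
    intro x hx
    have e := sum_block_mulVec H (fun i t => x (i, t))
    have e' := sum_block_mulVec H' (fun i t => x (i, t))
    exact e'.symm.trans ((h'.2 _).1 ((h.2 _).2 (e.trans hx)))
  refine ⟨H' * R, Matrix.ext_of_mulVec_single fun j => ?_⟩
  have hk := key (Pi.single j 1 - R.mulVec (H.mulVec (Pi.single j 1))) (by
    rw [Matrix.mulVec_sub, Matrix.mulVec_mulVec, hR, Matrix.one_mulVec, sub_self])
  rw [Matrix.mulVec_sub, sub_eq_zero] at hk
  rw [hk, Matrix.mulVec_mulVec, Matrix.mulVec_mulVec, Matrix.mul_assoc]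

/-- Two parity-check matrices of the same code differ by an invertible left factor. -/
lemma IsParityCheck.exists_isUnit_eq_mul {H H' : Matrix (Fin r × Fin ℓ) (Fin n × Fin ℓ) F}
    {C : Submodule F (Fin n → Fin ℓ → F)} (h : IsParityCheck H C) (h' : IsParityCheck H' C) :
    ∃ P : Matrix (Fin r × Fin ℓ) (Fin r × Fin ℓ) F, IsUnit P ∧ H' = P * H := by
  obtain ⟨P, hP⟩ := h.exists_eq_mul h'
  obtain ⟨Q, hQ⟩ := h'.exists_eq_mul h
  obtain ⟨R, hR⟩ := h'.exists_right_inverse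
  refine ⟨P, ?_, hP⟩
  have hPQ : P * Q = 1 := by
    calc P * Q = P * Q * (H' * R) := by rw [hR, Matrix.mul_one]
      _ = P * (Q * H') * R := by simp only [Matrix.mul_assoc]
      _ = 1 := by rw [← hQ, ← hP, hR]
  exact IsUnit.of_mul_eq_one Q hPQ

/-- `β_i(C)` may be computed with any parity-check matrix of `C`. -/
lemma nodeBandwidth_eq {H : Matrix (Fin r × Fin ℓ) (Fin n × Fin ℓ) F}
    {C : Submodule F (Fin n → Fin ℓ → F)} (h : IsParityCheck H C) (i : Fin n) :
    nodeBandwidth r C i =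
      sInf {b | ∃ M : Matrix (Fin ℓ) (Fin r × Fin ℓ) F,
        IsRepairMatrix H i M ∧ b = bandwidth H i M} := by
  unfold nodeBandwidth
  congr 1
  ext b
  constructor
  · rintro ⟨H', M, h', hM, rfl⟩
    obtain ⟨P, -, rfl⟩ := h.exists_isUnit_eq_mul h'
    refine ⟨M * P, ?_, ?_⟩
    · simpa [IsRepairMatrix, mul_block, Matrix.mul_assoc] using hM
    · simp [bandwidth, mul_block, Matrix.mul_assoc]
  · rintro ⟨M, hM, rfl⟩
    exact ⟨H, M, h, hM, rfl⟩

/-- Every node of an MDS array code of length `n ≥ r ≥ 1` has a repair matrix, so that the minimum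
defining `β_i(C)` is taken over a non-empty set. -/
lemma HasInvertibleBlocks.exists_isRepairMatrix {H : Matrix (Fin r × Fin ℓ) (Fin n × Fin ℓ) F}
    (h : HasInvertibleBlocks H) (hr : 0 < r) (hrn : r ≤ n) (i : Fin n) :
    ∃ M : Matrix (Fin ℓ) (Fin r × Fin ℓ) F, IsRepairMatrix H i M := by
  let e : Fin r ↪ Fin n :=
    (Fin.castLEEmb hrn).trans (Equiv.swap (Fin.castLE hrn ⟨0, hr⟩) i).toEmbedding
  have he : e ⟨0, hr⟩ = i := by simp [e]
  obtain ⟨N, hN⟩ := (h e).exists_left_inv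
  refine ⟨N.submatrix (fun t => (⟨0, hr⟩, t)) id, ?_⟩
  have : N.submatrix (fun t => (⟨0, hr⟩, t)) id * block H i = (1 : Matrix (Fin ℓ) (Fin ℓ) F) := by
    ext s t
    have := congrFun (congrFun hN (⟨0, hr⟩, s)) (⟨0, hr⟩, t)
    simpa [Matrix.mul_apply, block, he, Matrix.one_apply] using this
  rw [IsRepairMatrix, this]
  exact isUnit_one

end MDSArray

/-!
With `r = ℓ = 2` everything happens in the projective space `PG(3, q)`. The blocks of a parity-check
matrix of an MDS array code of length `10` have pairwise complementary column spaces, that is, they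
are ten pairwise skew lines `L_j` (`nodeLine`). A repair matrix `M` for node `i` has as its kernel a
line `K_i` skew to `L_i` (`repairLine`), and `rank (M H_j)` is `2` if `K_i` is skew to `L_j`, `1` if
it meets `L_j` in a point and `0` if `K_i = L_j`; in the last case the bandwidth is `16`.
Otherwise it is `9` plus the number of the lines other than `L_i` that `K_i` misses.

For the lower bound, suppose that every node has a repair line with bandwidth at most `10`, that is,
one that misses a set `D_i` of at most two of the lines, with `i ∈ D_i`. A minimal subfamily of the
`D_i` that covers all ten lines either consists of five disjoint pairs, or it contains four sets
with a union of at most seven elements and a line `x` that belongs to exactly one of them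
(`exists_private_or_perfect_matching`). In the latter case four of the `K_i` have three common
transversals among the `L_j`, so they lie in a regulus, and `L_x`, which meets three of them, would
meet the fourth (`not_disjoint_of_regulus`). In the former case there are five lines `K_0, …, K_4`
and ten skew lines `L_{i,a}` such that `K_i` meets `L_{j,a}` exactly for `i ≠ j`. In coordinates
with `L_{0,0}` and `L_{0,1}` as coordinate lines, `K_1, …, K_4` depend on two parameters `x` and
`y`, the remaining `L_{i,a}` are graphs of multiples `r_{i,a} A_i` of explicit matrices
(`transversalMatrix`), and `K_0` is the graph of a matrix `N` such that the `r_{i,a}` are the two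
roots of `det (N - r A_i)` (`no_skew_configuration`). The roots determine `N`, and a search through
the remaining possibilities finds no solution over the fields with eight and with nine
elements (`noSolution_GF8`, `noSolution_GF9`). The search depends on the field: the field with
seven elements does have solutions.

For the upper bound, ten pairwise skew lines and four lines are given explicitly, such that each of
the four misses at most three of the ten and each of the ten is missed by one of the four
(`hasTransversalDesign`).
-/

namespace MDSArray

/-! ### Concrete fields with eight and nine elements -/

/-- The field with eight elements, as `𝔽₂[t] / (t³ + t + 1)`: the polynomial `a₀ + a₁ t + a₂ t²`
is encoded by the number `a₀ + 2 a₁ + 4 a₂`, so that addition is `xor`. -/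
def GF8 : Type := Fin 8

/-- The field with nine elements, as `𝔽₃[t] / (t² + 1)`: the polynomial `a₀ + a₁ t` is encoded by
the number `a₀ + 3 a₁`. -/
def GF9 : Type := Fin 9

namespace GF8

instance : DecidableEq GF8 := inferInstanceAs (DecidableEq (Fin 8))
instance : Fintype GF8 := inferInstanceAs (Fintype (Fin 8))

/-- The element with a given code, read modulo `8`. -/
def ofCode (c : ℕ) : GF8 := (⟨c % 8, Nat.mod_lt _ (by norm_num)⟩ : Fin 8)

/-- The code of an element. -/
def code (a : GF8) : ℕ := Fin.val a

instance decidableForall (P : GF8 → Prop) [h : DecidablePred P] : Decidable (∀ a, P a) :=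
  @Nat.decidableForallFin 8 P h

/-- The code of the product by `t` of the polynomial with code `a`; the number `11` is the code of
`t³ + t + 1`. -/
def mulT (a : ℕ) : ℕ := if a < 4 then 2 * a else (2 * a) ^^^ 11

instance : Add GF8 := ⟨fun a b => ofCode (a.code ^^^ b.code)⟩
/-- Multiplication, by expanding the second factor in powers of `t`. -/
instance : Mul GF8 := ⟨fun a b => ofCode
  ((b.code % 2 * a.code) ^^^ (b.code / 2 % 2 * mulT a.code) ^^^ (b.code / 4 * mulT (mulT a.code)))⟩
instance : Zero GF8 := ⟨ofCode 0⟩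
instance : One GF8 := ⟨ofCode 1⟩
instance : Neg GF8 := ⟨fun a => a⟩
/-- The inverse of `a` is `a ^ 6`. -/
instance : Inv GF8 := ⟨fun a => a * a * (a * a) * (a * a)⟩

set_option maxRecDepth 10000 in
instance : Field GF8 where
  add_assoc := by decide +kernel
  zero_add := by decide +kernel
  add_zero := by decide +kernel
  add_comm := by decide +kernel
  nsmul := nsmulRec
  zsmul := zsmulRec
  neg_add_cancel := by decide +kernel
  mul_assoc := by decide +kernel
  one_mul := by decide +kernel
  mul_one := by decide +kernel
  mul_comm := by decide +kernel
  left_distrib := by decide +kernel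
  right_distrib := by decide +kernel
  zero_mul := by decide +kernel
  mul_zero := by decide +kernel
  exists_pair_ne := ⟨0, 1, by decide +kernel⟩
  mul_inv_cancel := by decide +kernel
  inv_zero := by decide +kernel
  nnqsmul := _
  qsmul := _

end GF8

namespace GF9

instance : DecidableEq GF9 := inferInstanceAs (DecidableEq (Fin 9))
instance : Fintype GF9 := inferInstanceAs (Fintype (Fin 9))

/-- The element with a given code, read modulo `9`. -/
def ofCode (c : ℕ) : GF9 := (⟨c % 9, Nat.mod_lt _ (by norm_num)⟩ : Fin 9)

/-- The code of an element. -/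
def code (a : GF9) : ℕ := Fin.val a

instance decidableForall (P : GF9 → Prop) [h : DecidablePred P] : Decidable (∀ a, P a) :=
  @Nat.decidableForallFin 9 P h

/-- The element `a + b t`, for `a` and `b` read modulo `3`. -/
def mk (a b : ℕ) : GF9 := ofCode (a % 3 + 3 * (b % 3))

/-- Addition of the coefficients; the code of an element is congruent to its constant coefficient
modulo `3`. -/
instance : Add GF9 := ⟨fun a b => mk (a.code + b.code) (a.code / 3 + b.code / 3)⟩
/-- Multiplication of polynomials in `t`, where `t² = 2`. -/
instance : Mul GF9 := ⟨fun a b => mk (a.code * b.code + 2 * ((a.code / 3) * (b.code / 3)))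
  (a.code * (b.code / 3) + (a.code / 3) * b.code)⟩
instance : Zero GF9 := ⟨ofCode 0⟩
instance : One GF9 := ⟨ofCode 1⟩
instance : Neg GF9 := ⟨fun a => a + a⟩
/-- The inverse of `a` is `a ^ 7`. -/
instance : Inv GF9 := ⟨fun a => a * a * a * (a * a) * (a * a)⟩

set_option maxRecDepth 10000 in
instance : Field GF9 where
  add_assoc := by decide +kernel
  zero_add := by decide +kernel
  add_zero := by decide +kernel
  add_comm := by decide +kernel
  nsmul := nsmulRec
  zsmul := zsmulRec
  neg_add_cancel := by decide +kernel
  mul_assoc := by decide +kernel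
  one_mul := by decide +kernel
  mul_one := by decide +kernel
  mul_comm := by decide +kernel
  left_distrib := by decide +kernel
  right_distrib := by decide +kernel
  zero_mul := by decide +kernel
  mul_zero := by decide +kernel
  exists_pair_ne := ⟨0, 1, by decide +kernel⟩
  mul_inv_cancel := by decide +kernel
  inv_zero := by decide +kernel
  nnqsmul := _
  qsmul := _

end GF9

/-! ### The finite search for transversal configurations -/

section Search
variable {F : Type*} [Field F]

/-- The triangular matrices `r • P` and `s • Q`, where `P` has diagonal `(a, b)` and `Q` has
diagonal `(c, d)`, agree in no diagonal entry; if both are lower triangular then their difference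
is invertible exactly in this case. -/
def Sep (a b c d r s : F) : Prop := r * a ≠ s * c ∧ r * b ≠ s * d

instance [DecidableEq F] (a b c d r s : F) : Decidable (Sep a b c d r s) :=
  inferInstanceAs (Decidable (_ ∧ _))

/-- The system of equations and inequations for a normalized transversal configuration has no
solution in `F`. Here `1` and `l` are the roots of `det (N - z A_3)`, `r` and `r'` those of
`det (N - z A_2)`, `t` and `t'` those of `det (N - z A_0)`, and `u` and `u'` those of
`det (N - z A_1)`, for the matrices `A_i` of `transversalMatrix x y` and a matrix `N` with rows
`(p, b)` and `(c, 1 + l - p)`. Only those inequations are listed that are needed to exclude a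
solution. The variables are ordered such that each equation and inequation can be tested as early
as possible, which keeps the search for a solution short. -/
def NoSolution (F : Type*) [Field F] : Prop :=
  ∀ x : F, (x ≠ 0 ∧ x ≠ 1) → ∀ y : F, (y ≠ 0 ∧ y ≠ 1 ∧ x ≠ y) → ∀ l : F, (l ≠ 0 ∧ l ≠ 1) →
  ∀ r : F, (Sep x y 1 1 r 1 ∧ Sep x y 1 1 r l) →
  ∀ r' : F, (x * y * r * r' = l ∧ r ≠ r' ∧ Sep x y 1 1 r' 1 ∧ Sep x y 1 1 r' l) →
  ∀ p : F, p * y + (1 + l - p) * x = x * y * (r + r') →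
  ∀ t : F, (Sep (1 - x) (1 - y) 1 1 t 1 ∧ Sep (1 - x) (1 - y) 1 1 t l ∧
    Sep (1 - x) (1 - y) x y t r ∧ Sep (1 - x) (1 - y) x y t r') →
  ∀ t' : F, ((1 - x) * (1 - y) * t * t' = l ∧ t ≠ t' ∧
    Sep (1 - x) (1 - y) 1 1 t' 1 ∧ Sep (1 - x) (1 - y) 1 1 t' l ∧
    Sep (1 - x) (1 - y) x y t' r ∧ Sep (1 - x) (1 - y) x y t' r') →
  ∀ b : F, p * (1 - y) + (1 + l - p) * (1 - x) - b * (y - x) = (1 - x) * (1 - y) * (t + t') →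
  ∀ c : F, p * (1 + l - p) - b * c = l →
  ∀ u : F, (p - u * (x * (1 - y))) * (1 + l - p - u * (y * (1 - x))) - (b - u * (y - x)) * c = 0 →
  ∀ u' : F, x * y * (1 - x) * (1 - y) * u * u' = l → u = u'

set_option maxRecDepth 10000 in
set_option synthInstance.maxSize 1000 in
set_option synthInstance.maxHeartbeats 400000 in
lemma noSolution_GF8 : NoSolution GF8 := by unfold NoSolution; decide +kernel

set_option maxRecDepth 10000 in
set_option synthInstance.maxSize 1000 in
set_option synthInstance.maxHeartbeats 400000 in
lemma noSolution_GF9 : NoSolution GF9 := by unfold NoSolution; decide +kernel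

lemma NoSolution.of_ringEquiv {K : Type*} [Field K] (h : NoSolution K) (e : F ≃+* K) :
    NoSolution F := by
  have ne : ∀ {a b : F}, a ≠ b → e a ≠ e b := fun hab hc => hab (e.injective hc)
  have sep : ∀ {a b c d r s : F}, Sep a b c d r s → Sep (e a) (e b) (e c) (e d) (e r) (e s) :=
    fun hs => ⟨by simpa only [map_mul] using ne hs.1, by simpa only [map_mul] using ne hs.2⟩
  intro x ⟨x0, x1⟩ y ⟨y0, y1, xy⟩ l ⟨l0, l1⟩ r ⟨r1, r2⟩ r' ⟨hr, rr, r3, r4⟩ p hp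
    t ⟨t1, t2, t3, t4⟩ t' ⟨ht, tt, t5, t6, t7, t8⟩ b hb c hc u hu u' hu'
  replace x0 := ne x0
  replace x1 := ne x1
  replace y0 := ne y0
  replace y1 := ne y1
  replace l0 := ne l0
  replace l1 := ne l1
  replace r1 := sep r1
  replace r2 := sep r2
  replace r3 := sep r3
  replace r4 := sep r4
  replace t1 := sep t1
  replace t2 := sep t2
  replace t3 := sep t3
  replace t4 := sep t4
  replace t5 := sep t5
  replace t6 := sep t6
  replace t7 := sep t7
  replace t8 := sep t8
  replace hr := congrArg e hr
  replace hp := congrArg e hp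
  replace ht := congrArg e ht
  replace hb := congrArg e hb
  replace hc := congrArg e hc
  replace hu := congrArg e hu
  replace hu' := congrArg e hu'
  simp only [map_mul, map_add, map_sub, map_one, map_zero] at *
  exact e.injective (h _ ⟨x0, x1⟩ _ ⟨y0, y1, ne xy⟩ _ ⟨l0, l1⟩ _ ⟨r1, r2⟩ _ ⟨hr, ne rr, r3, r4⟩
    _ hp _ ⟨t1, t2, t3, t4⟩ _ ⟨ht, ne tt, t5, t6, t7, t8⟩ _ hb _ hc _ hu _ hu')

lemma nonempty_ringEquiv_of_card {K : Type*} [Field K] [Fintype K]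
    (h : Nat.card F = Fintype.card K) : Nonempty (F ≃+* K) := by
  have : Finite F := Nat.finite_of_card_ne_zero (by rw [h]; exact Fintype.card_ne_zero)
  have := Fintype.ofFinite F
  exact ⟨FiniteField.ringEquivOfCardEq (by rw [← Nat.card_eq_fintype_card, h])⟩

lemma nonempty_ringEquiv_GF8_or_GF9 (hF : Nat.card F = 8 ∨ Nat.card F = 9) :
    Nonempty (F ≃+* GF8) ∨ Nonempty (F ≃+* GF9) :=
  hF.imp (fun h => nonempty_ringEquiv_of_card (h.trans (Fintype.card_fin 8).symm))
    (fun h => nonempty_ringEquiv_of_card (h.trans (Fintype.card_fin 9).symm))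

lemma noSolution (hF : Nat.card F = 8 ∨ Nat.card F = 9) : NoSolution F := by
  rcases nonempty_ringEquiv_GF8_or_GF9 hF with ⟨⟨e⟩⟩ | ⟨⟨e⟩⟩
  · exact noSolution_GF8.of_ringEquiv e
  · exact noSolution_GF9.of_ringEquiv e

/-- The matrix with index `i` maps `w_j` to a multiple of `z_j` for the three indices `j ≠ i`, where
`w` and `z` are the quadruples `(1, 0), (0, 1), (1, 1), (1, x)` and
`(1, 0), (0, 1), (1, 1), (1, y)`. It is unique up to scaling. -/
def transversalMatrix (x y : F) : Fin 4 → Matrix (Fin 2) (Fin 2) F :=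
  ![!![1 - x, 0; y - x, 1 - y], !![x * (1 - y), y - x; 0, y * (1 - x)], !![x, 0; 0, y],
    !![1, 0; 0, 1]]

lemma sep_of_det_ne_zero {a b c d e f r s : F}
    (h : (r • !![a, 0; e, b] - s • !![c, 0; f, d]).det ≠ 0) : Sep a b c d r s := by
  refine ⟨fun h0 => h ?_, fun h0 => h ?_⟩
  · simp only [Matrix.det_fin_two, Matrix.sub_apply, Matrix.smul_apply, Matrix.of_apply,
      Matrix.cons_val', Matrix.cons_val_zero, Matrix.cons_val_one, smul_eq_mul,
      Matrix.cons_val_fin_one]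
    linear_combination (r * b - s * d) * h0
  · simp only [Matrix.det_fin_two, Matrix.sub_apply, Matrix.smul_apply, Matrix.of_apply,
      Matrix.cons_val', Matrix.cons_val_zero, Matrix.cons_val_one, smul_eq_mul,
      Matrix.cons_val_fin_one]
    linear_combination (r * a - s * c) * h0

/-- The relations between the roots and the coefficients of a quadratic polynomial. -/
lemma vieta_of_ne {d t e r r' : F} (h : d - t * r + e * r ^ 2 = 0)
    (h' : d - t * r' + e * r' ^ 2 = 0) (hne : r ≠ r') : t = e * (r + r') ∧ e * r * r' = d := by
  have h1 : t = e * (r + r') := mul_left_cancel₀ (sub_ne_zero.2 hne) (by linear_combination h' - h)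
  exact ⟨h1, by rw [h1] at h; linear_combination -h⟩

/-- The normalization `r 3 0 = 1` can be achieved by scaling, and removes one parameter from the
search. -/
lemma no_normalized_transversal_configuration (hF : Nat.card F = 8 ∨ Nat.card F = 9) {x y : F}
    (hx0 : x ≠ 0) (hx1 : x ≠ 1) (hy0 : y ≠ 0) (hy1 : y ≠ 1) (hxy : x ≠ y)
    (N : Matrix (Fin 2) (Fin 2) F) (r : Fin 4 → Fin 2 → F) (hr0 : r 3 1 ≠ 0) (hr1 : r 3 0 = 1)
    (hN : ∀ i a, (N - r i a • transversalMatrix x y i).det = 0)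
    (hsep : ∀ i a j b, (i, a) ≠ (j, b) →
      (r i a • transversalMatrix x y i - r j b • transversalMatrix x y j).det ≠ 0) : False := by
  have hne : ∀ i, r i 0 ≠ r i 1 := fun i h => hsep i 0 i 1 (by simp) (by rw [h, sub_self]; simp)
  have hroot : ∀ i a, N.det - (N 0 0 * transversalMatrix x y i 1 1 +
      N 1 1 * transversalMatrix x y i 0 0 - N 0 1 * transversalMatrix x y i 1 0 -
      N 1 0 * transversalMatrix x y i 0 1) * r i a +
      (transversalMatrix x y i).det * r i a ^ 2 = 0 := by
    intro i a
    rw [← hN i a]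
    simp only [Matrix.det_fin_two, Matrix.sub_apply, Matrix.smul_apply, smul_eq_mul]
    ring
  have hv := fun i => vieta_of_ne (hroot i 0) (hroot i 1) (hne i)
  obtain ⟨htr, hdet⟩ := hv 3
  obtain ⟨hp, hr⟩ := hv 2
  obtain ⟨hb, ht⟩ := hv 0
  obtain ⟨-, hu⟩ := hv 1
  have hu0 := hN 1 0
  rw [← hdet] at hr ht hu
  simp only [transversalMatrix, Matrix.det_fin_two, Matrix.sub_apply, Matrix.smul_apply,
    smul_eq_mul, Matrix.of_apply, Matrix.cons_val', Matrix.cons_val, Matrix.cons_val_fin_one, hr1]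
    at htr hdet hp hr hb ht hu hu0
  have hs : N 1 1 = 1 + r 3 1 - N 0 0 := by linear_combination htr
  rw [hs] at hdet hp hb hu0
  have s23 : ∀ a b, Sep x y 1 1 (r 2 a) (r 3 b) := fun a b =>
    sep_of_det_ne_zero (hsep 2 a 3 b (by simp))
  have s03 : ∀ a b, Sep (1 - x) (1 - y) 1 1 (r 0 a) (r 3 b) := fun a b =>
    sep_of_det_ne_zero (hsep 0 a 3 b (by simp))
  have s02 : ∀ a b, Sep (1 - x) (1 - y) x y (r 0 a) (r 2 b) := fun a b =>
    sep_of_det_ne_zero (hsep 0 a 2 b (by simp))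
  refine hne 1 (noSolution hF x ⟨hx0, hx1⟩ y ⟨hy0, hy1, hxy⟩ (r 3 1) ⟨hr0, hr1 ▸ (hne 3).symm⟩
    (r 2 0) ⟨hr1 ▸ s23 0 0, s23 0 1⟩
    (r 2 1) ⟨by linear_combination hr, hne 2, hr1 ▸ s23 1 0, s23 1 1⟩
    (N 0 0) (by linear_combination hp)
    (r 0 0) ⟨hr1 ▸ s03 0 0, s03 0 1, s02 0 0, s02 0 1⟩
    (r 0 1) ⟨by linear_combination ht, hne 0, hr1 ▸ s03 1 0, s03 1 1, s02 1 0, s02 1 1⟩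
    (N 0 1) (by linear_combination hb) (N 1 0) (by linear_combination -hdet)
    (r 1 0) (by linear_combination hu0) (r 1 1) (by linear_combination hu))

/-- No graph of a matrix `N` meets the graphs of two multiples of each of the four matrices
`transversalMatrix x y i`, if these eight graphs are pairwise skew. -/
theorem no_transversal_configuration (hF : Nat.card F = 8 ∨ Nat.card F = 9) {x y : F}
    (hx0 : x ≠ 0) (hx1 : x ≠ 1) (hy0 : y ≠ 0) (hy1 : y ≠ 1) (hxy : x ≠ y)
    (N : Matrix (Fin 2) (Fin 2) F) (r : Fin 4 → Fin 2 → F) (hr0 : ∀ i a, r i a ≠ 0)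
    (hN : ∀ i a, (N - r i a • transversalMatrix x y i).det = 0)
    (hsep : ∀ i a j b, (i, a) ≠ (j, b) →
      (r i a • transversalMatrix x y i - r j b • transversalMatrix x y j).det ≠ 0) : False := by
  set ρ := (r 3 0)⁻¹ with hρ
  have hρ0 : ρ ≠ 0 := inv_ne_zero (hr0 3 0)
  refine no_normalized_transversal_configuration hF hx0 hx1 hy0 hy1 hxy (ρ • N)
    (fun i a => ρ * r i a) (mul_ne_zero hρ0 (hr0 3 1)) (inv_mul_cancel₀ (hr0 3 0))
    (fun i a => ?_) (fun i a j b h => ?_)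
  · rw [mul_smul, ← smul_sub, Matrix.det_smul, hN, mul_zero]
  · simp only [mul_smul]
    rw [← smul_sub, Matrix.det_smul]
    exact mul_ne_zero (pow_ne_zero _ hρ0) (hsep i a j b h)

end Search

/-! ### Transversals of skew lines and the regulus -/

section Lines
variable {F V : Type*} [Field F] [AddCommGroup V] [Module F V]

lemma not_disjoint_iff_exists {A B : Submodule F V} :
    ¬ Disjoint A B ↔ ∃ w, w ≠ 0 ∧ w ∈ A ∧ w ∈ B := by
  rw [Submodule.disjoint_def]
  push Not
  exact ⟨fun ⟨w, h1, h2, h3⟩ => ⟨w, h3, h1, h2⟩, fun ⟨w, h1, h2, h3⟩ => ⟨w, h2, h3, h1⟩⟩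

lemma eq_zero_of_disjoint {A B : Submodule F V} (h : Disjoint A B) {w : V} (hA : w ∈ A)
    (hB : w ∈ B) : w = 0 :=
  Submodule.disjoint_def.1 h w hA hB

lemma linearIndependent_pair_of_disjoint {A B : Submodule F V} (h : Disjoint A B) {u v : V}
    (hu : u ∈ A) (hv : v ∈ B) (hu0 : u ≠ 0) (hv0 : v ≠ 0) : LinearIndependent F ![u, v] := by
  refine LinearIndependent.pair_iff.2 fun a b hab => ?_
  have h1 : a • u = 0 := eq_zero_of_disjoint h (A.smul_mem a hu) (by
    rw [eq_neg_of_add_eq_zero_left hab]; exact B.neg_mem (B.smul_mem b hv))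
  have h2 : b • v = 0 := by rwa [h1, zero_add] at hab
  exact ⟨(smul_eq_zero.1 h1).resolve_right hu0, (smul_eq_zero.1 h2).resolve_right hv0⟩

lemma exists_eq_smul_add_smul [FiniteDimensional F V] {K : Submodule F V}
    (hK : Module.finrank F K = 2) {u v w : V} (huv : LinearIndependent F ![u, v])
    (hu : u ∈ K) (hv : v ∈ K) (hw : w ∈ K) : ∃ a b : F, w = a • u + b • v := by
  have hle : Submodule.span F (Set.range ![u, v]) ≤ K := by
    rw [Submodule.span_le]
    rintro _ ⟨i, rfl⟩
    fin_cases i <;> simpa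
  have heq := Submodule.eq_of_le_of_finrank_eq hle (by rw [finrank_span_eq_card huv, hK]; simp)
  rw [← heq] at hw
  simp only [Matrix.range_cons, Matrix.range_empty, Set.union_empty, Set.singleton_union] at hw
  obtain ⟨a, b, h⟩ := Submodule.mem_span_pair.1 hw
  exact ⟨a, b, h.symm⟩

/-- A line `K` that meets `A` in `u`, meets `B` in `v`, and also meets `L`, contains a vector
`u + t v` of `L`. Here and below, a line is a subspace of dimension two. -/
lemma exists_add_smul_mem [FiniteDimensional F V] {A B L K : Submodule F V} (hAB : Disjoint A B)
    (hLA : Disjoint L A) (hLB : Disjoint L B) (hK : Module.finrank F K = 2) (hKL : ¬ Disjoint K L)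
    {u v : V} (hu0 : u ≠ 0) (hv0 : v ≠ 0) (huK : u ∈ K) (hvK : v ∈ K) (hu : u ∈ A) (hv : v ∈ B) :
    ∃ t : F, t ≠ 0 ∧ u + t • v ∈ L := by
  obtain ⟨w, hw0, hwK, hwL⟩ := not_disjoint_iff_exists.1 hKL
  obtain ⟨a, b, rfl⟩ := exists_eq_smul_add_smul hK
    (linearIndependent_pair_of_disjoint hAB hu hv hu0 hv0) huK hvK hwK
  have ha : a ≠ 0 := by
    rintro rfl
    refine hw0 (eq_zero_of_disjoint hLB hwL ?_)
    simpa using B.smul_mem b hv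
  have hb : b ≠ 0 := by
    rintro rfl
    refine hw0 (eq_zero_of_disjoint hLA hwL ?_)
    simpa using A.smul_mem a hu
  refine ⟨a⁻¹ * b, mul_ne_zero (inv_ne_zero ha) hb, ?_⟩
  have := L.smul_mem a⁻¹ hwL
  rwa [smul_add, smul_smul, smul_smul, inv_mul_cancel₀ ha, one_smul] at this

/-- Different transversals of `A`, `B` and `L` meet `A` in different points: a linear relation
between the intersections with `A` gives one between the intersections with `B`, as `L` is the
graph of a bijection between (parts of) `A` and `B`. -/
lemma linearIndependent_of_ne [FiniteDimensional F V] {A B L K K' : Submodule F V}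
    (hAB : Disjoint A B) (hLB : Disjoint L B) (hK : Module.finrank F K = 2)
    (hK' : Module.finrank F K' = 2) (hne : K ≠ K') {u v u' v' : V} {t t' : F}
    (hu0 : u ≠ 0) (hv0 : v ≠ 0) (hu0' : u' ≠ 0) (hv0' : v' ≠ 0)
    (huK : u ∈ K) (hvK : v ∈ K) (hu : u ∈ A) (hv : v ∈ B)
    (huK' : u' ∈ K') (hvK' : v' ∈ K') (hu' : u' ∈ A) (hv' : v' ∈ B)
    (ht : t ≠ 0) (ht' : t' ≠ 0) (hL : u + t • v ∈ L) (hL' : u' + t' • v' ∈ L) :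
    LinearIndependent F ![u, u'] := by
  have hsub : ∀ {P Q : Submodule F V} {p q : V}, Module.finrank F P = 2 → Module.finrank F Q = 2 →
      p ≠ 0 → q ≠ 0 → p ∈ P → q ∈ P → p ∈ A → q ∈ B → p ∈ Q → q ∈ Q → P = Q := by
    intro P Q p q hP hQ hp hq hpP hqP hpA hqB hpQ hqQ
    refine Submodule.eq_of_le_of_finrank_eq (fun w hw => ?_) (hP.trans hQ.symm)
    obtain ⟨a, b, rfl⟩ := exists_eq_smul_add_smul hP
      (linearIndependent_pair_of_disjoint hAB hpA hqB hp hq) hpP hqP hw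
    exact Q.add_mem (Q.smul_mem _ hpQ) (Q.smul_mem _ hqQ)
  refine LinearIndependent.pair_iff.2 fun a b hab => ?_
  have h0 : (a * t) • v + (b * t') • v' = 0 := by
    refine eq_zero_of_disjoint hLB ?_ (B.add_mem (B.smul_mem _ hv) (B.smul_mem _ hv'))
    have h := L.add_mem (L.smul_mem a hL) (L.smul_mem b hL')
    have e : a • (u + t • v) + b • (u' + t' • v') =
        (a • u + b • u') + ((a * t) • v + (b * t') • v') := by module
    rwa [e, hab, zero_add] at h
  have mem : ∀ {c d : F} {p q : V} {Q : Submodule F V}, c • p + d • q = 0 → c ≠ 0 → q ∈ Q →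
      p ∈ Q := by
    intro c d p q Q h hc hq
    have : p = (-(c⁻¹ * d)) • q := by
      have h2 := congrArg (c⁻¹ • ·) h
      simp only [smul_add, smul_smul, inv_mul_cancel₀ hc, one_smul, smul_zero] at h2
      rw [neg_smul]
      exact eq_neg_of_add_eq_zero_left h2
    rw [this]
    exact Q.smul_mem _ hq
  by_contra hcon
  by_cases ha : a = 0
  · have hb : b ≠ 0 := fun hb => hcon ⟨ha, hb⟩
    rw [add_comm] at hab h0
    exact hne (hsub hK' hK hu0' hv0' huK' hvK' hu' hv' (mem hab hb huK)
      (mem h0 (mul_ne_zero hb ht') hvK)).symm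
  · exact hne (hsub hK hK' hu0 hv0 huK hvK hu hv (mem hab ha huK')
      (mem h0 (mul_ne_zero ha ht) hvK'))

lemma exists_transversal_pair [FiniteDimensional F V] {A B C K : Submodule F V}
    (hAB : Disjoint A B) (hCA : Disjoint C A) (hCB : Disjoint C B)
    (hK : Module.finrank F K = 2) (hKA : ¬ Disjoint K A) (hKB : ¬ Disjoint K B)
    (hKC : ¬ Disjoint K C) :
    ∃ u v : V, u ≠ 0 ∧ v ≠ 0 ∧ u ∈ K ∧ v ∈ K ∧ u ∈ A ∧ v ∈ B ∧ u + v ∈ C := by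
  obtain ⟨u, hu0, huK, huA⟩ := not_disjoint_iff_exists.1 hKA
  obtain ⟨v, hv0, hvK, hvB⟩ := not_disjoint_iff_exists.1 hKB
  obtain ⟨t, ht, h⟩ := exists_add_smul_mem hAB hCA hCB hK hKC hu0 hv0 huK hvK huA hvB
  exact ⟨u, t • v, hu0, smul_ne_zero ht hv0, huK, K.smul_mem t hvK, huA, B.smul_mem t hvB, h⟩

/-- A line `D` that meets three of the transversals of the skew lines `A`, `B`, `C` meets all of
them: `C` and `D` are graphs of linear maps from `A` to `B`, which agree up to scalars on three
points of `A`, hence are proportional. -/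
theorem not_disjoint_of_regulus [FiniteDimensional F V] {A B C D : Submodule F V}
    {K : Fin 4 → Submodule F V} (hA : Module.finrank F A = 2)
    (hAB : Disjoint A B) (hCA : Disjoint C A) (hCB : Disjoint C B)
    (hDA : Disjoint D A) (hDB : Disjoint D B) (hK : ∀ i, Module.finrank F (K i) = 2)
    (hKA : ∀ i, ¬ Disjoint (K i) A) (hKB : ∀ i, ¬ Disjoint (K i) B)
    (hKC : ∀ i, ¬ Disjoint (K i) C) (hKD : ∀ i, i ≠ 0 → ¬ Disjoint (K i) D)
    (h12 : K 1 ≠ K 2) (h13 : K 1 ≠ K 3) (h23 : K 2 ≠ K 3) : ¬ Disjoint (K 0) D := by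
  choose u v hu0 hv0 huK hvK huA hvB huv using fun i =>
    exists_transversal_pair hAB hCA hCB (hK i) (hKA i) (hKB i) (hKC i)
  have huvC : ∀ i, u i + (1 : F) • v i ∈ C := fun i => by simpa using huv i
  have hvuC : ∀ i, v i + (1 : F) • u i ∈ C := fun i => by simpa [add_comm] using huv i
  have indU : ∀ i j, K i ≠ K j → LinearIndependent F ![u i, u j] := fun i j hij =>
    linearIndependent_of_ne hAB hCB (hK i) (hK j) hij (hu0 i) (hv0 i) (hu0 j) (hv0 j) (huK i)
      (hvK i) (huA i) (hvB i) (huK j) (hvK j) (huA j) (hvB j) one_ne_zero one_ne_zero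
      (huvC i) (huvC j)
  have indV : ∀ i j, K i ≠ K j → LinearIndependent F ![v i, v j] := fun i j hij =>
    linearIndependent_of_ne hAB.symm hCA (hK i) (hK j) hij (hv0 i) (hu0 i) (hv0 j) (hu0 j) (hvK i)
      (huK i) (hvB i) (huA i) (hvK j) (huK j) (hvB j) (huA j) one_ne_zero one_ne_zero
      (hvuC i) (hvuC j)
  -- `C` is the graph of an isomorphism `A → B` that maps each `u i` to `v i`.
  have transfer : ∀ i (a b : F), u i = a • u 1 + b • u 2 → v i = a • v 1 + b • v 2 := by
    intro i a b h
    refine sub_eq_zero.1 (eq_zero_of_disjoint hCB ?_ (B.sub_mem (hvB i)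
      (B.add_mem (B.smul_mem a (hvB 1)) (B.smul_mem b (hvB 2)))))
    have e : v i - (a • v 1 + b • v 2) = (u i + v i) - (a • (u 1 + v 1) + b • (u 2 + v 2)) := by
      rw [h]; module
    rw [e]
    exact C.sub_mem (huv i) (C.add_mem (C.smul_mem a (huv 1)) (C.smul_mem b (huv 2)))
  have coord : ∀ i, ∃ a b : F, u i = a • u 1 + b • u 2 := fun i =>
    exists_eq_smul_add_smul hA (indU 1 2 h12) (huA 1) (huA 2) (huA i)
  obtain ⟨a, b, hab⟩ := coord 3
  have hab' := transfer 3 a b hab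
  have ha : a ≠ 0 := by
    rintro rfl
    have := LinearIndependent.pair_iff.1 (indU 2 3 h23) b (-1) (by rw [hab]; module)
    simp at this
  have hb : b ≠ 0 := by
    rintro rfl
    have := LinearIndependent.pair_iff.1 (indU 1 3 h13) a (-1) (by rw [hab]; module)
    simp at this
  have hD : ∀ i, i ≠ 0 → ∃ t : F, t ≠ 0 ∧ u i + t • v i ∈ D := fun i hi =>
    exists_add_smul_mem hAB hDA hDB (hK i) (hKD i hi) (hu0 i) (hv0 i) (huK i) (hvK i) (huA i)
      (hvB i)
  obtain ⟨t1, -, ht1⟩ := hD 1 (by decide)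
  obtain ⟨t2, -, ht2⟩ := hD 2 (by decide)
  obtain ⟨t3, -, ht3⟩ := hD 3 (by decide)
  have hz : (a * (t1 - t3)) • v 1 + (b * (t2 - t3)) • v 2 = 0 := by
    refine eq_zero_of_disjoint hDB ?_
      (B.add_mem (B.smul_mem _ (hvB 1)) (B.smul_mem _ (hvB 2)))
    have e : (a * (t1 - t3)) • v 1 + (b * (t2 - t3)) • v 2 =
        a • (u 1 + t1 • v 1) + b • (u 2 + t2 • v 2) - (u 3 + t3 • v 3) := by
      rw [hab, hab']; module
    rw [e]
    exact D.sub_mem (D.add_mem (D.smul_mem a ht1) (D.smul_mem b ht2)) ht3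
  obtain ⟨hz1, hz2⟩ := LinearIndependent.pair_iff.1 (indV 1 2 h12) _ _ hz
  have e1 : t1 = t3 := sub_eq_zero.1 ((mul_eq_zero.1 hz1).resolve_left ha)
  have e2 : t2 = t3 := sub_eq_zero.1 ((mul_eq_zero.1 hz2).resolve_left hb)
  subst e1 e2
  obtain ⟨c, d, hcd⟩ := coord 0
  have hcd' := transfer 0 c d hcd
  refine not_disjoint_iff_exists.2 ⟨u 0 + t2 • v 0, fun h => ?_,
    (K 0).add_mem (huK 0) ((K 0).smul_mem _ (hvK 0)), ?_⟩
  · refine hu0 0 (eq_zero_of_disjoint hAB (huA 0) ?_)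
    rw [eq_neg_of_add_eq_zero_left h]
    exact B.neg_mem (B.smul_mem _ (hvB 0))
  · have e : u 0 + t2 • v 0 = c • (u 1 + t2 • v 1) + d • (u 2 + t2 • v 2) := by
      rw [hcd, hcd']; module
    rw [e]
    exact D.add_mem (D.smul_mem c ht1) (D.smul_mem d ht2)

end Lines

/-! ### Graphs in coordinates -/

section Coordinates
variable {F V : Type*} [Field F] [AddCommGroup V] [Module F V]

/-- The subspace `L` contains the graph of the linear map from the span of `e` to the span of `f`
whose matrix is `P`: the image of `e j` has the `j`-th column of `P` as its coordinates. -/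
def ContainsGraph (e f : Fin 2 → V) (P : Matrix (Fin 2) (Fin 2) F) (L : Submodule F V) : Prop :=
  ∀ j, e j + P 0 j • f 0 + P 1 j • f 1 ∈ L

section Graph
variable {A B L L' : Submodule F V} {e f : Fin 2 → V} {P Q : Matrix (Fin 2) (Fin 2) F}

lemma coeff_eq_zero_of_add_eq_zero (hAB : Disjoint A B) (he : ∀ j, e j ∈ A) (hf : ∀ j, f j ∈ B)
    (hle : LinearIndependent F ![e 0, e 1]) (hlf : LinearIndependent F ![f 0, f 1]) {a b c d : F}
    (h : a • e 0 + b • e 1 + (c • f 0 + d • f 1) = 0) : (a = 0 ∧ b = 0) ∧ c = 0 ∧ d = 0 := by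
  have hB : c • f 0 + d • f 1 ∈ B := B.add_mem (B.smul_mem _ (hf 0)) (B.smul_mem _ (hf 1))
  have hA : a • e 0 + b • e 1 = 0 :=
    eq_zero_of_disjoint hAB (A.add_mem (A.smul_mem _ (he 0)) (A.smul_mem _ (he 1))) (by
      rw [eq_neg_of_add_eq_zero_left h]; exact B.neg_mem hB)
  rw [hA, zero_add] at h
  exact ⟨LinearIndependent.pair_iff.1 hle _ _ hA, LinearIndependent.pair_iff.1 hlf _ _ h⟩

lemma linearIndependent_graph (hAB : Disjoint A B) (he : ∀ j, e j ∈ A)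
    (hf : ∀ j, f j ∈ B) (hle : LinearIndependent F ![e 0, e 1])
    (hlf : LinearIndependent F ![f 0, f 1]) :
    LinearIndependent F ![e 0 + P 0 0 • f 0 + P 1 0 • f 1, e 1 + P 0 1 • f 0 + P 1 1 • f 1] := by
  refine LinearIndependent.pair_iff.2 fun a b hab => ?_
  refine (coeff_eq_zero_of_add_eq_zero hAB he hf hle hlf (c := a * P 0 0 + b * P 0 1)
    (d := a * P 1 0 + b * P 1 1) ?_).1
  rw [← hab]; module

lemma ContainsGraph.det_sub_ne_zero (hAB : Disjoint A B) (he : ∀ j, e j ∈ A) (hf : ∀ j, f j ∈ B)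
    (hle : LinearIndependent F ![e 0, e 1]) (hlf : LinearIndependent F ![f 0, f 1])
    (hP : ContainsGraph e f P L) (hQ : ContainsGraph e f Q L') (hd : Disjoint L L') :
    (P - Q).det ≠ 0 := by
  intro h
  obtain ⟨w, hw0, hw⟩ := Matrix.exists_mulVec_eq_zero_iff.2 h
  have h0 := congrFun hw 0
  have h1 := congrFun hw 1
  simp only [Matrix.mulVec, dotProduct, Fin.sum_univ_two, Matrix.sub_apply, Pi.zero_apply] at h0 h1
  have hL := L.add_mem (L.smul_mem (w 0) (hP 0)) (L.smul_mem (w 1) (hP 1))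
  have hL' := L'.add_mem (L'.smul_mem (w 0) (hQ 0)) (L'.smul_mem (w 1) (hQ 1))
  have heq : w 0 • (e 0 + P 0 0 • f 0 + P 1 0 • f 1) + w 1 • (e 1 + P 0 1 • f 0 + P 1 1 • f 1) =
      w 0 • (e 0 + Q 0 0 • f 0 + Q 1 0 • f 1) + w 1 • (e 1 + Q 0 1 • f 0 + Q 1 1 • f 1) := by
    linear_combination (norm := module) h0 • f 0 + h1 • f 1
  have hz := LinearIndependent.pair_iff.1
    (linearIndependent_graph hAB he hf hle hlf) _ _
    (eq_zero_of_disjoint hd hL (heq ▸ hL'))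
  refine hw0 (funext fun j => ?_)
  fin_cases j
  exacts [hz.1, hz.2]

lemma ContainsGraph.det_sub_eq_zero [FiniteDimensional F V] (hAB : Disjoint A B)
    (he : ∀ j, e j ∈ A) (hf : ∀ j, f j ∈ B)
    (hle : LinearIndependent F ![e 0, e 1]) (hlf : LinearIndependent F ![f 0, f 1])
    (hL : Module.finrank F L = 2) (hL' : Module.finrank F L' = 2)
    (hP : ContainsGraph e f P L) (hQ : ContainsGraph e f Q L') (hd : ¬ Disjoint L L') :
    (P - Q).det = 0 := by
  obtain ⟨w, hw0, hw, hw'⟩ := not_disjoint_iff_exists.1 hd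
  obtain ⟨a, b, h⟩ := exists_eq_smul_add_smul hL
    (linearIndependent_graph hAB he hf hle hlf) (hP 0) (hP 1) hw
  obtain ⟨a', b', h'⟩ := exists_eq_smul_add_smul hL'
    (linearIndependent_graph hAB he hf hle hlf) (hQ 0) (hQ 1) hw'
  obtain ⟨⟨ha, hb⟩, hc, hd⟩ := coeff_eq_zero_of_add_eq_zero hAB he hf hle hlf
    (a := a - a') (b := b - b')
    (c := a * P 0 0 + b * P 0 1 - (a' * Q 0 0 + b' * Q 0 1))
    (d := a * P 1 0 + b * P 1 1 - (a' * Q 1 0 + b' * Q 1 1)) (by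
      rw [← sub_self w]; nth_rw 1 [h]; rw [h']; module)
  rw [sub_eq_zero] at ha hb
  subst ha hb
  refine Matrix.exists_mulVec_eq_zero_iff.1 ⟨![a, b], fun h0 => hw0 ?_, ?_⟩
  · have h1 : a = 0 := congrFun h0 0
    have h2 : b = 0 := congrFun h0 1
    rw [h, h1, h2]; simp
  · ext j
    fin_cases j
    · simp [Matrix.mulVec, dotProduct, Fin.sum_univ_two]; linear_combination hc
    · simp [Matrix.mulVec, dotProduct, Fin.sum_univ_two]; linear_combination hd

end Graph

/-- Four pairwise independent vectors of a two-dimensional space become `e 0`, `e 1`, `e 0 + e 1`,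
`e 0 + x e 1` after scaling, in a suitable basis `e`. -/
lemma exists_normal_form [FiniteDimensional F V] {A : Submodule F V} (hA : Module.finrank F A = 2)
    {u : Fin 4 → V} (hu : ∀ i, u i ∈ A) (ind : ∀ i j, i ≠ j → LinearIndependent F ![u i, u j]) :
    ∃ (e : Fin 2 → V) (x : F) (c : Fin 4 → F), LinearIndependent F ![e 0, e 1] ∧ x ≠ 0 ∧ x ≠ 1 ∧
      e 0 = c 0 • u 0 ∧ e 1 = c 1 • u 1 ∧ e 0 + e 1 = c 2 • u 2 ∧ e 0 + x • e 1 = c 3 • u 3 := by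
  have coord := fun i =>
    exists_eq_smul_add_smul hA (ind 0 1 (by decide)) (hu 0) (hu 1) (hu i)
  obtain ⟨a, b, h2⟩ := coord 2
  obtain ⟨c, d, h3⟩ := coord 3
  have ha : a ≠ 0 := by
    rintro rfl
    have := LinearIndependent.pair_iff.1 (ind 1 2 (by decide)) b (-1) (by rw [h2]; module)
    simp at this
  have hb : b ≠ 0 := by
    rintro rfl
    have := LinearIndependent.pair_iff.1 (ind 0 2 (by decide)) a (-1) (by rw [h2]; module)
    simp at this
  have hc : c ≠ 0 := by
    rintro rfl
    have := LinearIndependent.pair_iff.1 (ind 1 3 (by decide)) d (-1) (by rw [h3]; module)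
    simp at this
  have hd : d ≠ 0 := by
    rintro rfl
    have := LinearIndependent.pair_iff.1 (ind 0 3 (by decide)) c (-1) (by rw [h3]; module)
    simp at this
  refine ⟨![a • u 0, b • u 1], a * c⁻¹ * d * b⁻¹, ![a, b, 1, a * c⁻¹], ?_, ?_, ?_, rfl, rfl,
    ?_, ?_⟩
  · refine LinearIndependent.pair_iff.2 fun s t h => ?_
    have := LinearIndependent.pair_iff.1 (ind 0 1 (by decide)) (s * a) (t * b) (by
      simpa [mul_smul] using h)
    simpa [ha, hb] using this
  · positivity
  · intro h
    have h' : a * d = c * b := by field_simp at h; linear_combination h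
    have := LinearIndependent.pair_iff.1 (ind 2 3 (by decide)) c (-a) (by
      rw [h2, h3]
      linear_combination (norm := module) (-h') • u 1)
    exact hc this.1
  · simp [h2]
  · simp only [Matrix.cons_val_zero, Matrix.cons_val_one, Matrix.cons_val, h3, smul_add, smul_smul]
    congr 2 <;> field_simp

end Coordinates

/-! ### Five transversals, each missing two of ten lines -/

section Configuration
variable {F V : Type*} [Field F] [AddCommGroup V] [Module F V]

lemma exists_containsGraph_of_disjoint [FiniteDimensional F V] {B K : Submodule F V}
    (hV : Module.finrank F V = 4) (hB : Module.finrank F B = 2) (hK : Module.finrank F K = 2)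
    (hKB : Disjoint K B) {e f : Fin 2 → V} (hf : ∀ j, f j ∈ B)
    (hlf : LinearIndependent F ![f 0, f 1]) :
    ∃ N : Matrix (Fin 2) (Fin 2) F, ContainsGraph e f N K := by
  have htop := Submodule.eq_top_of_disjoint K B (by rw [hV, hB, hK]) hKB
  have : ∀ j, ∃ c d : F, e j + c • f 0 + d • f 1 ∈ K := by
    intro j
    obtain ⟨k, hk, b, hb, hkb⟩ := Submodule.mem_sup.1 (htop ▸ Submodule.mem_top : e j ∈ K ⊔ B)
    obtain ⟨c, d, rfl⟩ := exists_eq_smul_add_smul hB hlf (hf 0) (hf 1) hb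
    refine ⟨-c, -d, ?_⟩
    rw [← hkb]
    convert hk using 1
    module
  choose c d h using this
  exact ⟨Matrix.of ![c, d], h⟩

section Transversals
variable {B L : Submodule F V} {e f : Fin 2 → V} {x y : F}

lemma coeff_eq_zero_of_mem (hLB : Disjoint L B) (hf : ∀ j, f j ∈ B)
    (hlf : LinearIndependent F ![f 0, f 1]) {a b : F} (h : a • f 0 + b • f 1 ∈ L) :
    a = 0 ∧ b = 0 :=
  LinearIndependent.pair_iff.1 hlf _ _
    (eq_zero_of_disjoint hLB h (B.add_mem (B.smul_mem _ (hf 0)) (B.smul_mem _ (hf 1))))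

/-- In this lemma and in the following ones, `L` meets the lines with three of the indices `0`, `1`,
`2`, `3` among the spans of `(e 0, f 0)`, `(e 1, f 1)`, `(e 0 + e 1, f 0 + f 1)` and
`(e 0 + x • e 1, f 0 + y • f 1)`. The linear relation between the three vectors in the span of `e`
then also holds for the vectors in the span of `f`, which determines `L` up to one scalar. If
`x = y` then the four lines lie in a regulus, and `L` also meets the fourth. -/
lemma containsGraph_of_mem_123 (hLB : Disjoint L B) (hf : ∀ j, f j ∈ B)
    (hlf : LinearIndependent F ![f 0, f 1]) (hx : x ≠ 1) (hy : y ≠ 1) {t₁ t₂ t₃ : F} (ht : t₁ ≠ 0)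
    (h1 : e 1 + t₁ • f 1 ∈ L) (h2 : e 0 + e 1 + t₂ • (f 0 + f 1) ∈ L)
    (h3 : e 0 + x • e 1 + t₃ • (f 0 + y • f 1) ∈ L) :
    (x = y → e 0 + t₁ • f 0 ∈ L) ∧
      ∃ r : F, r ≠ 0 ∧ ContainsGraph e f (r • transversalMatrix x y 0) L := by
  have hx' : 1 - x ≠ 0 := sub_ne_zero.2 hx.symm
  have hy' : 1 - y ≠ 0 := sub_ne_zero.2 hy.symm
  obtain ⟨r1, r2⟩ := coeff_eq_zero_of_mem hLB hf hlf (a := t₃ - t₂)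
      (b := (1 - x) * t₁ - t₂ + y * t₃) (by
    have := L.add_mem (L.sub_mem h3 h2) (L.smul_mem (1 - x) h1)
    convert this using 1
    module)
  have e3 : t₃ = t₂ := sub_eq_zero.1 r1
  subst e3
  have key : t₁ * (1 - x) = t₃ * (1 - y) := by linear_combination r2
  refine ⟨fun hxy => ?_, t₁ / (1 - y), div_ne_zero ht hy', ?_⟩
  · have : t₁ = t₃ := mul_right_cancel₀ hy' (by rw [← key, hxy])
    subst this
    convert L.sub_mem h2 h1 using 1
    module
  · have e3 : t₃ = t₁ / (1 - y) * (1 - x) := by field_simp; linear_combination -key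
    have e1 : t₁ = t₁ / (1 - y) * (1 - y) := by field_simp
    set r := t₁ / (1 - y)
    rw [e3] at h2
    rw [e1] at h1
    intro j
    fin_cases j
    · convert L.sub_mem h2 h1 using 1
      simp [transversalMatrix]
      module
    · convert h1 using 1
      simp [transversalMatrix]

lemma containsGraph_of_mem_023 (hLB : Disjoint L B) (hf : ∀ j, f j ∈ B)
    (hlf : LinearIndependent F ![f 0, f 1]) (hx0 : x ≠ 0) (hx : x ≠ 1) (hy : y ≠ 1)
    {t₀ t₂ t₃ : F} (ht : t₀ ≠ 0)
    (h0 : e 0 + t₀ • f 0 ∈ L) (h2 : e 0 + e 1 + t₂ • (f 0 + f 1) ∈ L)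
    (h3 : e 0 + x • e 1 + t₃ • (f 0 + y • f 1) ∈ L) :
    ∃ r : F, r ≠ 0 ∧ ContainsGraph e f (r • transversalMatrix x y 1) L := by
  have hx' : 1 - x ≠ 0 := sub_ne_zero.2 hx.symm
  have hy' : 1 - y ≠ 0 := sub_ne_zero.2 hy.symm
  obtain ⟨r1, r2⟩ := coeff_eq_zero_of_mem hLB hf hlf (a := t₃ - x * t₂ - (1 - x) * t₀)
      (b := y * t₃ - x * t₂) (by
    have := L.sub_mem (L.sub_mem h3 (L.smul_mem x h2)) (L.smul_mem (1 - x) h0)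
    convert this using 1
    module)
  refine ⟨t₀ / (x * (1 - y)), div_ne_zero ht (mul_ne_zero hx0 hy'), ?_⟩
  have e0 : t₀ = t₀ / (x * (1 - y)) * (x * (1 - y)) := by field_simp
  have e2 : t₂ = t₀ / (x * (1 - y)) * (y * (1 - x)) := by
    field_simp
    linear_combination y * r1 - r2
  set r := t₀ / (x * (1 - y))
  rw [e2] at h2
  rw [e0] at h0
  intro j
  fin_cases j
  · convert h0 using 1
    simp [transversalMatrix]
  · convert L.sub_mem h2 h0 using 1
    simp [transversalMatrix]
    module

lemma containsGraph_of_mem_013 (hLB : Disjoint L B) (hf : ∀ j, f j ∈ B)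
    (hlf : LinearIndependent F ![f 0, f 1]) (hx0 : x ≠ 0) {t₀ t₁ t₃ : F} (ht : t₀ ≠ 0)
    (h0 : e 0 + t₀ • f 0 ∈ L) (h1 : e 1 + t₁ • f 1 ∈ L)
    (h3 : e 0 + x • e 1 + t₃ • (f 0 + y • f 1) ∈ L) :
    ∃ r : F, r ≠ 0 ∧ ContainsGraph e f (r • transversalMatrix x y 2) L := by
  obtain ⟨r1, r2⟩ := coeff_eq_zero_of_mem hLB hf hlf (a := t₃ - t₀) (b := y * t₃ - x * t₁) (by
    have := L.sub_mem (L.sub_mem h3 (L.smul_mem x h1)) h0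
    convert this using 1
    module)
  refine ⟨t₀ / x, div_ne_zero ht hx0, ?_⟩
  have e0 : t₀ = t₀ / x * x := by field_simp
  have e1 : t₁ = t₀ / x * y := by
    field_simp
    linear_combination y * r1 - r2
  set r := t₀ / x
  rw [e0] at h0
  rw [e1] at h1
  intro j
  fin_cases j
  · convert h0 using 1
    simp [transversalMatrix]
  · convert h1 using 1
    simp [transversalMatrix]

lemma containsGraph_of_mem_012 (hLB : Disjoint L B) (hf : ∀ j, f j ∈ B)
    (hlf : LinearIndependent F ![f 0, f 1]) {t₀ t₁ t₂ : F} (ht : t₀ ≠ 0)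
    (h0 : e 0 + t₀ • f 0 ∈ L) (h1 : e 1 + t₁ • f 1 ∈ L)
    (h2 : e 0 + e 1 + t₂ • (f 0 + f 1) ∈ L) :
    ∃ r : F, r ≠ 0 ∧ ContainsGraph e f (r • transversalMatrix x y 3) L := by
  obtain ⟨r1, r2⟩ := coeff_eq_zero_of_mem hLB hf hlf (a := t₂ - t₀) (b := t₂ - t₁) (by
    have := L.sub_mem (L.sub_mem h2 h1) h0
    convert this using 1
    module)
  have e1 : t₁ = t₀ := by linear_combination r1 - r2
  rw [e1] at h1
  refine ⟨t₀, ht, fun j => ?_⟩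
  fin_cases j
  · convert h0 using 1
    simp [transversalMatrix]
  · convert h1 using 1
    simp [transversalMatrix]

end Transversals

/-- There is no configuration of five lines `K₀`, `K i` and ten pairwise skew lines `A`, `B`,
`L i a` such that `K₀` misses exactly `A` and `B`, and `K i` misses exactly `L i 0` and `L i 1`. -/
theorem no_skew_configuration [FiniteDimensional F V] (hF : Nat.card F = 8 ∨ Nat.card F = 9)
    (hV : Module.finrank F V = 4) {A B K₀ : Submodule F V} {K : Fin 4 → Submodule F V}
    {L : Fin 4 → Fin 2 → Submodule F V} (hA : Module.finrank F A = 2)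
    (hB : Module.finrank F B = 2) (hK₀ : Module.finrank F K₀ = 2)
    (hK : ∀ i, Module.finrank F (K i) = 2) (hL : ∀ i a, Module.finrank F (L i a) = 2)
    (hAB : Disjoint A B) (hLA : ∀ i a, Disjoint (L i a) A) (hLB : ∀ i a, Disjoint (L i a) B)
    (hLL : ∀ i a j b, (i, a) ≠ (j, b) → Disjoint (L i a) (L j b))
    (hK₀B : Disjoint K₀ B) (hK₀L : ∀ i a, ¬ Disjoint K₀ (L i a))
    (hKA : ∀ i, ¬ Disjoint (K i) A) (hKB : ∀ i, ¬ Disjoint (K i) B)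
    (hKL : ∀ i j a, i ≠ j → ¬ Disjoint (K i) (L j a))
    (hKL' : ∀ i a, Disjoint (K i) (L i a)) : False := by
  choose u hu0 huK huA using fun i => not_disjoint_iff_exists.1 (hKA i)
  choose v hv0 hvK hvB using fun i => not_disjoint_iff_exists.1 (hKB i)
  have hmem : ∀ i j a, i ≠ j → ∃ t : F, t ≠ 0 ∧ u i + t • v i ∈ L j a := fun i j a hij =>
    exists_add_smul_mem hAB (hLA j a) (hLB j a) (hK i) (hKL i j a hij) (hu0 i) (hv0 i) (huK i)
      (hvK i) (huA i) (hvB i)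
  have hKne : ∀ i j, i ≠ j → K i ≠ K j := fun i j hij h =>
    hKL i j 0 hij (h ▸ hKL' j 0)
  have third : ∀ i j : Fin 4, ∃ k, i ≠ k ∧ j ≠ k := by decide
  have indU : ∀ i j, i ≠ j → LinearIndependent F ![u i, u j] := by
    intro i j hij
    obtain ⟨k, hik, hjk⟩ := third i j
    obtain ⟨t, ht, h⟩ := hmem i k 0 hik
    obtain ⟨t', ht', h'⟩ := hmem j k 0 hjk
    exact linearIndependent_of_ne hAB (hLB k 0) (hK i) (hK j) (hKne i j hij) (hu0 i) (hv0 i)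
      (hu0 j) (hv0 j) (huK i) (hvK i) (huA i) (hvB i) (huK j) (hvK j) (huA j) (hvB j) ht ht' h h'
  have indV : ∀ i j, i ≠ j → LinearIndependent F ![v i, v j] := by
    intro i j hij
    obtain ⟨k, hik, hjk⟩ := third i j
    have swap : ∀ {i} {t : F}, t ≠ 0 → u i + t • v i ∈ L k 0 → v i + t⁻¹ • u i ∈ L k 0 := by
      intro i t ht h
      convert (L k 0).smul_mem t⁻¹ h using 1
      rw [smul_add, smul_smul, inv_mul_cancel₀ ht, one_smul, add_comm]
    obtain ⟨t, ht, h⟩ := hmem i k 0 hik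
    obtain ⟨t', ht', h'⟩ := hmem j k 0 hjk
    exact linearIndependent_of_ne hAB.symm (hLA k 0) (hK i) (hK j) (hKne i j hij) (hv0 i) (hu0 i)
      (hv0 j) (hu0 j) (hvK i) (huK i) (hvB i) (huA i) (hvK j) (huK j) (hvB j) (huA j)
      (inv_ne_zero ht) (inv_ne_zero ht') (swap ht h) (swap ht' h')
  obtain ⟨e, x, c, hle, hx0, hx1, he0, he1, he2, he3⟩ := exists_normal_form hA huA indU
  obtain ⟨f, y, d, hlf, hy0, hy1, hf0, hf1, hf2, hf3⟩ := exists_normal_form hB hvB indV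
  have he : ∀ j, e j ∈ A := by
    intro j
    fin_cases j
    · exact he0 ▸ A.smul_mem _ (huA 0)
    · exact he1 ▸ A.smul_mem _ (huA 1)
  have hf : ∀ j, f j ∈ B := by
    intro j
    fin_cases j
    · exact hf0 ▸ B.smul_mem _ (hvB 0)
    · exact hf1 ▸ B.smul_mem _ (hvB 1)
  have ne_zero : ∀ {g : Fin 2 → V} (a b : F), LinearIndependent F ![g 0, g 1] →
      a • g 0 + b • g 1 = 0 → a = 0 ∧ b = 0 := fun a b h => LinearIndependent.pair_iff.1 h a b
  have p0 : ∀ j a, 0 ≠ j → ∃ t : F, t ≠ 0 ∧ e 0 + t • f 0 ∈ L j a := fun j a hj =>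
    exists_add_smul_mem hAB (hLA j a) (hLB j a) (hK 0) (hKL 0 j a hj)
      (hle.ne_zero 0) (hlf.ne_zero 0) (he0 ▸ (K 0).smul_mem _ (huK 0))
      (hf0 ▸ (K 0).smul_mem _ (hvK 0)) (he 0) (hf 0)
  have p1 : ∀ j a, 1 ≠ j → ∃ t : F, t ≠ 0 ∧ e 1 + t • f 1 ∈ L j a := fun j a hj =>
    exists_add_smul_mem hAB (hLA j a) (hLB j a) (hK 1) (hKL 1 j a hj)
      (hle.ne_zero 1) (hlf.ne_zero 1) (he1 ▸ (K 1).smul_mem _ (huK 1))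
      (hf1 ▸ (K 1).smul_mem _ (hvK 1)) (he 1) (hf 1)
  have p2 : ∀ j a, 2 ≠ j → ∃ t : F, t ≠ 0 ∧ e 0 + e 1 + t • (f 0 + f 1) ∈ L j a := fun j a hj =>
    exists_add_smul_mem hAB (hLA j a) (hLB j a) (hK 2) (hKL 2 j a hj)
      (fun h => one_ne_zero (ne_zero (1 : F) 1 hle (by simpa using h)).1)
      (fun h => one_ne_zero (ne_zero (1 : F) 1 hlf (by simpa using h)).1)
      (he2 ▸ (K 2).smul_mem _ (huK 2)) (hf2 ▸ (K 2).smul_mem _ (hvK 2))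
      (A.add_mem (he 0) (he 1)) (B.add_mem (hf 0) (hf 1))
  have p3 : ∀ j a, 3 ≠ j → ∃ t : F, t ≠ 0 ∧ e 0 + x • e 1 + t • (f 0 + y • f 1) ∈ L j a :=
    fun j a hj =>
    exists_add_smul_mem hAB (hLA j a) (hLB j a) (hK 3) (hKL 3 j a hj)
      (fun h => one_ne_zero (ne_zero (1 : F) x hle (by simpa using h)).1)
      (fun h => one_ne_zero (ne_zero (1 : F) y hlf (by simpa using h)).1)
      (he3 ▸ (K 3).smul_mem _ (huK 3)) (hf3 ▸ (K 3).smul_mem _ (hvK 3))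
      (A.add_mem (he 0) (A.smul_mem _ (he 1))) (B.add_mem (hf 0) (B.smul_mem _ (hf 1)))
  have graph0 : ∀ a, (x = y → ∃ t : F, e 0 + t • f 0 ∈ L 0 a) ∧
      ∃ r : F, r ≠ 0 ∧ ContainsGraph e f (r • transversalMatrix x y 0) (L 0 a) := by
    intro a
    obtain ⟨t₁, ht₁, h1⟩ := p1 0 a (by decide)
    obtain ⟨t₂, -, h2⟩ := p2 0 a (by decide)
    obtain ⟨t₃, -, h3⟩ := p3 0 a (by decide)
    have h := containsGraph_of_mem_123 (hLB 0 a) hf hlf hx1 hy1 ht₁ h1 h2 h3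
    exact ⟨fun hxy => ⟨t₁, h.1 hxy⟩, h.2⟩
  have hxy : x ≠ y := by
    intro hxy
    obtain ⟨t, ht⟩ := (graph0 0).1 hxy
    have hz := eq_zero_of_disjoint (hKL' 0 0) ((K 0).add_mem (he0 ▸ (K 0).smul_mem _ (huK 0))
      ((K 0).smul_mem t (hf0 ▸ (K 0).smul_mem _ (hvK 0)))) ht
    exact one_ne_zero (coeff_eq_zero_of_add_eq_zero hAB he hf hle hlf
      (a := 1) (b := 0) (c := t) (d := 0)
      (by simpa using hz)).1.1
  have graph : ∀ i a, ∃ r : F, r ≠ 0 ∧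
      ContainsGraph e f (r • transversalMatrix x y i) (L i a) := by
    intro i a
    fin_cases i
    · exact (graph0 a).2
    · obtain ⟨t₀, ht₀, h0⟩ := p0 1 a (by decide)
      obtain ⟨t₂, -, h2⟩ := p2 1 a (by decide)
      obtain ⟨t₃, -, h3⟩ := p3 1 a (by decide)
      exact containsGraph_of_mem_023 (hLB 1 a) hf hlf hx0 hx1 hy1 ht₀ h0 h2 h3
    · obtain ⟨t₀, ht₀, h0⟩ := p0 2 a (by decide)
      obtain ⟨t₁, -, h1⟩ := p1 2 a (by decide)
      obtain ⟨t₃, -, h3⟩ := p3 2 a (by decide)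
      exact containsGraph_of_mem_013 (hLB 2 a) hf hlf hx0 ht₀ h0 h1 h3
    · obtain ⟨t₀, ht₀, h0⟩ := p0 3 a (by decide)
      obtain ⟨t₁, -, h1⟩ := p1 3 a (by decide)
      obtain ⟨t₂, -, h2⟩ := p2 3 a (by decide)
      exact containsGraph_of_mem_012 (hLB 3 a) hf hlf ht₀ h0 h1 h2
  choose r hr0 hr using graph
  obtain ⟨N, hN⟩ := exists_containsGraph_of_disjoint hV hB hK₀ hK₀B hf hlf (e := e)
  exact no_transversal_configuration hF hx0 hx1 hy0 hy1 hxy N r hr0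
    (fun i a => ContainsGraph.det_sub_eq_zero hAB he hf hle hlf hK₀ (hL i a) hN (hr i a)
      (hK₀L i a))
    (fun i a j b h => ContainsGraph.det_sub_ne_zero hAB he hf hle hlf (hr i a) (hr j b)
      (hLL i a j b h))

end Configuration

/-! ### Covering the lines by the sets of missed lines -/

section Covering

variable {ι : Type*} [Fintype ι] [DecidableEq ι]

/-- Sets `D i` of at most two elements, with `i ∈ D i`, on ten points: either five of them partition
the points into pairs, or there are four with a small union, one of which has an element `x` that
is in none of the others. Both are found in a minimal subfamily that covers all points, where every
set has an element of its own. -/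
theorem exists_private_or_perfect_matching (hι : Fintype.card ι = 10) (D : ι → Finset ι)
    (hD : ∀ i, i ∈ D i) (hD2 : ∀ i, (D i).card ≤ 2) :
    (∃ (k : Fin 4 → ι) (x : ι), x ∈ D (k 0) ∧ (∀ i, i ≠ 0 → x ∉ D (k i)) ∧
      D (k 1) ≠ D (k 2) ∧ D (k 1) ≠ D (k 3) ∧ D (k 2) ≠ D (k 3) ∧
      (Finset.univ.biUnion fun i => D (k i)).card ≤ 7) ∨
    ∃ (k : Fin 5 → ι) (l : Fin 5 → Fin 2 → ι),
      (Function.Injective fun p : Fin 5 × Fin 2 => l p.1 p.2) ∧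
      ∀ i, l i 0 = k i ∧ D (k i) = {l i 0, l i 1} := by
  obtain ⟨S, hS⟩ := exists_minimal_of_wellFoundedLT
    (fun S : Finset ι => S.biUnion D = Finset.univ) ⟨Finset.univ, by
      ext i; simpa using ⟨i, hD i⟩⟩
  have hcov : S.biUnion D = Finset.univ := hS.prop
  have hpriv : ∀ s ∈ S, ∃ x ∈ D s, ∀ t ∈ S, t ≠ s → x ∉ D t := by
    intro s hs
    by_contra! hcon
    have hcov' : (S.erase s).biUnion D = Finset.univ := by
      refine Finset.eq_univ_of_forall fun x => ?_
      obtain ⟨t, ht, hxt⟩ := Finset.mem_biUnion.1 (hcov ▸ Finset.mem_univ x : x ∈ S.biUnion D)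
      by_cases hts : t = s
      · subst hts
        obtain ⟨t', ht', hne, hx⟩ := hcon x hxt
        exact Finset.mem_biUnion.2 ⟨t', Finset.mem_erase.2 ⟨hne, ht'⟩, hx⟩
      · exact Finset.mem_biUnion.2 ⟨t, Finset.mem_erase.2 ⟨hts, ht⟩, hxt⟩
    exact Finset.notMem_erase s S (hS.le_of_le hcov' (Finset.erase_subset s S) hs)
  have hcard : 5 ≤ S.card := by
    have h := Finset.card_biUnion_le_card_mul S D 2 fun s _ => hD2 s
    rw [hcov, Finset.card_univ, hι] at h
    omega
  have hinj : ∀ s ∈ S, ∀ t ∈ S, s ≠ t → D s ≠ D t := by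
    intro s hs t ht hst h
    obtain ⟨x, hx, hx'⟩ := hpriv s hs
    exact hx' t ht hst.symm (h ▸ hx)
  -- Two members of `S` whose sets have a union of at most three elements, together with any other
  -- two members, give the first alternative.
  have build : ∀ s ∈ S, ∀ t ∈ S, s ≠ t → (D s ∪ D t).card ≤ 3 →
    (∃ (k : Fin 4 → ι) (x : ι), x ∈ D (k 0) ∧ (∀ i, i ≠ 0 → x ∉ D (k i)) ∧
      D (k 1) ≠ D (k 2) ∧ D (k 1) ≠ D (k 3) ∧ D (k 2) ≠ D (k 3) ∧
      (Finset.univ.biUnion fun i => D (k i)).card ≤ 7) := by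
    intro s hs t ht hst hc
    have h2 : 1 < ((S.erase s).erase t).card := by
      rw [Finset.card_erase_of_mem (Finset.mem_erase.2 ⟨hst.symm, ht⟩),
        Finset.card_erase_of_mem hs]
      omega
    obtain ⟨a, ha, b, hb, hab⟩ := Finset.one_lt_card.1 h2
    simp only [Finset.mem_erase] at ha hb
    obtain ⟨hat, has, haS⟩ := ha
    obtain ⟨hbt, hbs, hbS⟩ := hb
    obtain ⟨x, hx, hx'⟩ := hpriv s hs
    refine ⟨![s, t, a, b], x, hx, ?_, hinj t ht a haS hat.symm, hinj t ht b hbS hbt.symm,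
      hinj a haS b hbS hab, ?_⟩
    · intro i hi
      fin_cases i
      · exact absurd rfl hi
      · exact hx' t ht hst.symm
      · exact hx' a haS has
      · exact hx' b hbS hbs
    · have he : (Finset.univ.biUnion fun i => D (![s, t, a, b] i)) = (D s ∪ D t) ∪ (D a ∪ D b) := by
        ext z
        simp [Fin.exists_fin_succ]
      rw [he]
      have h3 := Finset.card_union_le (D s ∪ D t) (D a ∪ D b)
      have h4 := Finset.card_union_le (D a) (D b)
      have := hD2 a
      have := hD2 b
      omega
  by_cases hpairs : ∃ s ∈ S, ∃ t ∈ S, s ≠ t ∧ (D s ∪ D t).card ≤ 3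
  · obtain ⟨s, hs, t, ht, hst, hc⟩ := hpairs
    exact Or.inl (build s hs t ht hst hc)
  right
  push Not at hpairs
  have hsz : ∀ s ∈ S, ∀ t ∈ S, s ≠ t → (D s).card = 2 ∧ Disjoint (D s) (D t) := by
    intro s hs t ht hst
    have h1 := hpairs s hs t ht hst
    have h2 := Finset.card_union_add_card_inter (D s) (D t)
    have := hD2 s
    have := hD2 t
    refine ⟨by omega, Finset.disjoint_iff_inter_eq_empty.2 (Finset.card_eq_zero.1 (by omega))⟩
  have hsz2 : ∀ s ∈ S, (D s).card = 2 := by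
    intro s hs
    obtain ⟨t, ht, hts⟩ := Finset.exists_mem_ne (by omega : 1 < S.card) s
    exact (hsz s hs t ht hts.symm).1
  have hS5 : S.card = 5 := by
    have h := Finset.card_biUnion (s := S) (t := D) fun s hs t ht hst => (hsz s hs t ht hst).2
    rw [hcov, Finset.card_univ, hι, Finset.sum_congr rfl hsz2, Finset.sum_const, smul_eq_mul] at h
    omega
  have hpartner : ∀ s ∈ S, ∃ t, s ≠ t ∧ D s = {s, t} := by
    intro s hs
    obtain ⟨a, b, hab, h⟩ := Finset.card_eq_two.1 (hsz2 s hs)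
    have := hD s
    rw [h, Finset.mem_insert, Finset.mem_singleton] at this
    rcases this with rfl | rfl
    · exact ⟨b, hab, h⟩
    · exact ⟨a, hab.symm, by rw [h, Finset.pair_comm]⟩
  choose! g hg1 hg2 using hpartner
  let k : Fin 5 ≃ S := (S.equivFinOfCardEq hS5).symm
  refine ⟨fun i => k i, fun i => ![k i, g (k i)], ?_, fun i => ⟨rfl, hg2 _ (k i).2⟩⟩
  have hmem : ∀ (i : Fin 5) (a : Fin 2), (![(k i : ι), g (k i)] : Fin 2 → ι) a ∈ D (k i) := by
    intro i a
    rw [hg2 _ (k i).2]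
    fin_cases a <;> simp
  rintro ⟨i, a⟩ ⟨j, b⟩ h
  simp only at h
  have hij : i = j := by
    by_contra hij
    have hne : (k i : ι) ≠ k j := fun h => hij (k.injective (Subtype.ext h))
    exact Finset.disjoint_left.1 (hsz _ (k i).2 _ (k j).2 hne).2 (hmem i a) (h ▸ hmem j b)
  subst hij
  have := hg1 _ (k i).2
  fin_cases a <;> fin_cases b
  · rfl
  · exact absurd h this
  · exact absurd h.symm this
  · rfl

end Covering

/-- Ten pairwise skew lines `L i` in a space of dimension four cannot be such that each `L i` is
missed by a line `K i` that misses at most one further `L j`. -/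
theorem false_of_ten_lines {F V : Type*} [Field F] [AddCommGroup V] [Module F V]
    [FiniteDimensional F V] (hF : Nat.card F = 8 ∨ Nat.card F = 9)
    (hV : Module.finrank F V = 4) {L K : Fin 10 → Submodule F V}
    (hL : ∀ i, Module.finrank F (L i) = 2) (hLL : ∀ i j, i ≠ j → Disjoint (L i) (L j))
    (hK : ∀ i, Module.finrank F (K i) = 2) (D : Fin 10 → Finset (Fin 10))
    (hD : ∀ i, i ∈ D i) (hD2 : ∀ i, (D i).card ≤ 2)
    (hKL : ∀ i j, Disjoint (K i) (L j) ↔ j ∈ D i) : False := by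
  have hKD : ∀ i j, D i ≠ D j → K i ≠ K j := fun i j hij h =>
    hij (Finset.ext fun x => by rw [← hKL, ← hKL, h])
  rcases exists_private_or_perfect_matching (Fintype.card_fin 10) D hD hD2 with
    ⟨k, x, hx0, hx, h12, h13, h23, hcard⟩ | ⟨k, l, hl, hk⟩
  · have hc : 2 < (Finset.univ.biUnion fun i => D (k i))ᶜ.card := by
      rw [Finset.card_compl, Fintype.card_fin]; omega
    obtain ⟨a, b, c, ha, hb, hc, hab, hac, hbc⟩ := Finset.two_lt_card_iff.1 hc
    simp only [Finset.mem_compl, Finset.mem_biUnion, Finset.mem_univ, true_and, not_exists]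
      at ha hb hc
    have hxa : x ≠ a := fun h => ha 0 (h ▸ hx0)
    have hxb : x ≠ b := fun h => hb 0 (h ▸ hx0)
    exact not_disjoint_of_regulus (K := fun i => K (k i)) (hL a) (hLL a b hab) (hLL c a hac.symm)
      (hLL c b hbc.symm) (hLL x a hxa) (hLL x b hxb) (fun i => hK _)
      (fun i h => ha i ((hKL _ _).1 h)) (fun i h => hb i ((hKL _ _).1 h))
      (fun i h => hc i ((hKL _ _).1 h)) (fun i hi h => hx i hi ((hKL _ _).1 h))
      (hKD _ _ h12) (hKD _ _ h13) (hKD _ _ h23) ((hKL _ _).2 hx0)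
  · have hd : ∀ i j a, Disjoint (K (k i)) (L (l j a)) ↔ i = j := by
      intro i j a
      rw [hKL, (hk i).2]
      constructor
      · intro h
        rw [Finset.mem_insert, Finset.mem_singleton] at h
        rcases h with h | h
        · exact (Prod.ext_iff.1 (hl (a₁ := (j, a)) (a₂ := (i, 0)) h)).1.symm
        · exact (Prod.ext_iff.1 (hl (a₁ := (j, a)) (a₂ := (i, 1)) h)).1.symm
      · rintro rfl
        fin_cases a <;> simp
    have hdL : ∀ i a j b, (i, a) ≠ (j, b) → Disjoint (L (l i a)) (L (l j b)) :=
      fun i a j b h => hLL _ _ fun h' => h (hl h')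
    exact no_skew_configuration hF hV (A := L (l 0 0)) (B := L (l 0 1)) (K₀ := K (k 0))
      (K := fun i => K (k i.succ)) (L := fun i a => L (l i.succ a)) (hL _) (hL _) (hK _)
      (fun _ => hK _) (fun _ _ => hL _) (hdL _ _ _ _ (by simp))
      (fun i a => hdL _ _ _ _ (by simp)) (fun i a => hdL _ _ _ _ (by simp))
      (fun i a j b h => hdL _ _ _ _ (by simpa using h)) ((hd _ _ _).2 rfl)
      (fun i a h => (Fin.succ_ne_zero i).symm ((hd _ _ _).1 h))
      (fun i h => Fin.succ_ne_zero i ((hd _ _ _).1 h))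
      (fun i h => Fin.succ_ne_zero i ((hd _ _ _).1 h))
      (fun i j a hij h => hij (Fin.succ_injective _ ((hd _ _ _).1 h)))
      (fun i a => (hd _ _ _).2 rfl)

/-! ### The lower bound -/

open Matrix

section LowerBound
variable {F : Type*} [Field F]

section Blocks
variable {n : ℕ} {H : Matrix (Fin 2 × Fin 2) (Fin n × Fin 2) F}

/-- The column space of the block of node `j`, a line of the projective space `PG(3, q)`. -/
def nodeLine (H : Matrix (Fin 2 × Fin 2) (Fin n × Fin 2) F) (j : Fin n) :
    Submodule F (Fin 2 × Fin 2 → F) :=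
  LinearMap.range (block H j).mulVecLin

/-- The kernel of a repair matrix, a line of the projective space `PG(3, q)`. -/
def repairLine (M : Matrix (Fin 2) (Fin 2 × Fin 2) F) : Submodule F (Fin 2 × Fin 2 → F) :=
  LinearMap.ker M.mulVecLin

lemma HasInvertibleBlocks.eq_zero_of_add_eq_zero (h : HasInvertibleBlocks H) {i j : Fin n}
    (hij : i ≠ j) {a b : Fin 2 → F} (hab : block H i *ᵥ a + block H j *ᵥ b = 0) :
    a = 0 ∧ b = 0 := by
  let e : Fin 2 ↪ Fin n := ⟨![i, j], by
    intro s t hst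
    fin_cases s <;> fin_cases t <;> simp_all [eq_comm]⟩
  have hinj := Matrix.mulVec_injective_iff_isUnit.2 (h e)
  have hz : (fun p : Fin 2 × Fin 2 => (![a, b] : Fin 2 → Fin 2 → F) p.1 p.2) = 0 := by
    refine hinj ?_
    rw [Matrix.mulVec_zero, ← hab]
    ext p
    have h0 : e 0 = i := rfl
    have h1 : e 1 = j := rfl
    simp [Matrix.mulVec, dotProduct, block, Fintype.sum_prod_type, h0, h1]
  exact ⟨funext fun t => congrFun hz (0, t), funext fun t => congrFun hz (1, t)⟩

lemma HasInvertibleBlocks.injective_mulVec_block (h : HasInvertibleBlocks H) (hn : 2 ≤ n)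
    (i : Fin n) : Function.Injective (block H i).mulVecLin := by
  have : Nontrivial (Fin n) := Fin.nontrivial_iff_two_le.2 hn
  obtain ⟨j, hj⟩ := exists_ne i
  rw [injective_iff_map_eq_zero]
  intro a ha
  exact (h.eq_zero_of_add_eq_zero hj.symm (a := a) (b := 0) (by simpa using ha)).1

lemma HasInvertibleBlocks.finrank_nodeLine (h : HasInvertibleBlocks H) (hn : 2 ≤ n) (i : Fin n) :
    Module.finrank F (nodeLine H i) = 2 := by
  rw [nodeLine, LinearMap.finrank_range_of_inj (h.injective_mulVec_block hn i)]
  simp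

lemma HasInvertibleBlocks.disjoint_nodeLine (h : HasInvertibleBlocks H) {i j : Fin n}
    (hij : i ≠ j) : Disjoint (nodeLine H i) (nodeLine H j) := by
  rw [Submodule.disjoint_def]
  rintro _ ⟨a, rfl⟩ ⟨b, hb⟩
  have := (h.eq_zero_of_add_eq_zero hij (a := a) (b := -b) (by
    rw [mulVec_neg]
    exact sub_eq_zero.2 hb.symm ▸ (sub_eq_add_neg _ _).symm)).1
  rw [this, map_zero]

variable {M : Matrix (Fin 2) (Fin 2 × Fin 2) F}

lemma disjoint_repairLine_iff {i : Fin n} (hi : Function.Injective (block H i).mulVecLin) :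
    Disjoint (repairLine M) (nodeLine H i) ↔ IsUnit (M * block H i) := by
  rw [← Matrix.mulVec_injective_iff_isUnit, Submodule.disjoint_def]
  constructor
  · intro h
    change Function.Injective (M * block H i).mulVecLin
    rw [injective_iff_map_eq_zero]
    intro a ha
    refine (injective_iff_map_eq_zero _).1 hi a (h _ ?_ ⟨a, rfl⟩)
    simpa [repairLine] using ha
  · rintro h _ hM ⟨a, rfl⟩
    have : a = 0 := h (by
      rw [mulVec_zero, ← mulVec_mulVec]
      exact hM)
    rw [this, map_zero]

lemma IsRepairMatrix.finrank_repairLine {i : Fin n} (h : IsRepairMatrix H i M) :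
    Module.finrank F (repairLine M) = 2 := by
  have hs : Function.Surjective M.mulVecLin := by
    have h1 := Matrix.mulVec_surjective_iff_isUnit.2 h
    intro y
    obtain ⟨x, hx⟩ := h1 y
    exact ⟨block H i *ᵥ x, by rw [← hx, ← mulVec_mulVec]; rfl⟩
  have h2 := LinearMap.finrank_range_add_finrank_ker M.mulVecLin
  rw [LinearMap.range_eq_top.2 hs, finrank_top] at h2
  simp only [Module.finrank_fintype_fun_eq_card, Fintype.card_fin, Fintype.card_prod] at h2
  rw [repairLine]
  omega

/-- If `M H_j = 0` then the repair line is the line of node `j`, and misses all the others. -/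
lemma isUnit_mul_block_of_eq_zero (h : HasInvertibleBlocks H) (hn : 2 ≤ n) {i j k : Fin n}
    (hM : IsRepairMatrix H i M) (hj : M * block H j = 0) (hjk : j ≠ k) :
    IsUnit (M * block H k) := by
  have hle : nodeLine H j ≤ repairLine M := by
    rintro _ ⟨a, rfl⟩
    simp [repairLine, hj]
  rw [← disjoint_repairLine_iff (h.injective_mulVec_block hn k),
    ← Submodule.eq_of_le_of_finrank_eq hle
      ((h.finrank_nodeLine hn j).trans hM.finrank_repairLine.symm)]
  exact h.disjoint_nodeLine hjk

lemma rank_eq_two {P : Matrix (Fin 2) (Fin 2) F} (h : IsUnit P) : P.rank = 2 := by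
  rw [Matrix.rank_of_isUnit _ h, Fintype.card_fin]

lemma eq_zero_of_rank_eq_zero {P : Matrix (Fin 2) (Fin 2) F} (h : P.rank = 0) : P = 0 := by
  rw [Matrix.rank, Submodule.finrank_eq_zero, LinearMap.range_eq_bot] at h
  exact Matrix.toLin'.injective (h.trans (map_zero _).symm)

/-- The number of node lines missed by the repair line is at most `b + 2 - n`, where `b` bounds the
bandwidth, unless the repair line is itself a node line; this is excluded by `hbn`. -/
lemma card_isUnit_mul_block_le (h : HasInvertibleBlocks H) (hn : 2 ≤ n) {i : Fin n}
    [DecidablePred fun j => IsUnit (M * block H j)] (hM : IsRepairMatrix H i M) {b : ℕ}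
    (hb : bandwidth H i M ≤ b) (hbn : b + 4 < 2 * n) :
    (Finset.univ.filter fun j => IsUnit (M * block H j)).card + n ≤ b + 2 := by
  set T : Finset (Fin n) := Finset.univ.filter fun j => IsUnit (M * block H j) with hT
  have hiT : i ∈ T := by simpa [hT, IsRepairMatrix] using hM
  have hcardn : (Finset.univ.erase i).card = n - 1 := by simp
  by_cases hz : ∃ j, M * block H j = 0
  · -- The repair line is a node line, so that the bandwidth is `2 (n - 2)`.
    exfalso
    obtain ⟨j, hj⟩ := hz
    have hlow : ∑ k ∈ (Finset.univ.erase i).erase j, 2 ≤ bandwidth H i M := by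
      refine le_trans (Finset.sum_le_sum fun k hk => ?_)
        (Finset.sum_le_sum_of_subset (Finset.erase_subset j _))
      rw [rank_eq_two (isUnit_mul_block_of_eq_zero h hn hM hj (Finset.ne_of_mem_erase hk).symm)]
    have := Finset.pred_card_le_card_erase (s := Finset.univ.erase i) (a := j)
    rw [Finset.sum_const, smul_eq_mul] at hlow
    omega
  · push Not at hz
    have hlow : ∑ k ∈ Finset.univ.erase i, (1 + if k ∈ T then 1 else 0) ≤ bandwidth H i M := by
      refine Finset.sum_le_sum fun k hk => ?_
      split_ifs with hkT
      · rw [rank_eq_two (by simpa [hT] using hkT)]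
      · exact Nat.one_le_iff_ne_zero.2 fun h0 => hz k (eq_zero_of_rank_eq_zero h0)
    rw [Finset.sum_add_distrib, ← Finset.sum_filter, Finset.sum_const, Finset.sum_const,
      smul_eq_mul, smul_eq_mul, Finset.filter_mem_eq_inter, Finset.erase_inter,
      Finset.univ_inter, Finset.card_erase_of_mem hiT] at hlow
    omega

end Blocks

theorem eleven_le_worstBandwidth (hF : Nat.card F = 8 ∨ Nat.card F = 9)
    {C : Submodule F (Fin 10 → Fin 2 → F)} (hC : IsMDSArrayCode 2 C) :
    11 ≤ worstBandwidth 2 C := by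
  classical
  by_contra! hlt
  obtain ⟨-, H, hpc, hH⟩ := hC
  have hM : ∀ i, ∃ M, IsRepairMatrix H i M ∧ bandwidth H i M ≤ 10 := by
    intro i
    have hle : nodeBandwidth 2 C i ≤ 10 :=
      (Finset.le_sup (f := nodeBandwidth 2 C) (Finset.mem_univ i)).trans (Nat.lt_succ_iff.1 hlt)
    rw [nodeBandwidth_eq hpc] at hle
    obtain ⟨M₀, hM₀⟩ := hH.exists_isRepairMatrix two_pos (by norm_num) i
    obtain ⟨M, hM, h⟩ := Nat.sInf_mem (s := {b | ∃ M, IsRepairMatrix H i M ∧ b = bandwidth H i M})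
      ⟨_, M₀, hM₀, rfl⟩
    exact ⟨M, hM, h ▸ hle⟩
  choose M hM hb using hM
  have hinj := hH.injective_mulVec_block (by norm_num : 2 ≤ 10)
  refine false_of_ten_lines hF (V := Fin 2 × Fin 2 → F) (by simp) (L := nodeLine H)
    (K := fun i => repairLine (M i)) (hH.finrank_nodeLine (by norm_num))
    (fun i j => hH.disjoint_nodeLine) (fun i => (hM i).finrank_repairLine)
    (fun i => Finset.univ.filter fun j => IsUnit (M i * block H j)) (fun i => ?_) (fun i => ?_)
    (fun i j => ?_)
  · simpa [IsRepairMatrix] using hM i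
  · have := card_isUnit_mul_block_le hH (by norm_num) (hM i) (hb i) (by norm_num)
    omega
  · rw [disjoint_repairLine_iff (hinj j)]
    simp

end LowerBound

/-! ### A code with repair bandwidth eleven -/

section UpperBound
variable {F : Type*} [Field F]

/-- There are ten lines, the graphs of the `A i`, that are pairwise skew, and four lines, the graphs
of the `N c`, each of which misses at most three of the ten (those in `s c`), such that the `i`-th
of the ten lines is missed by the graph of `N (k i)`. -/
def HasTransversalDesign (F : Type*) [Field F] : Prop :=
  ∃ (A : Fin 10 → Matrix (Fin 2) (Fin 2) F) (N : Fin 4 → Matrix (Fin 2) (Fin 2) F)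
    (k : Fin 10 → Fin 4) (s : Fin 4 → Finset (Fin 10)),
    (∀ i j, i ≠ j → (A i - A j).det ≠ 0) ∧ (∀ i, (A i - N (k i)).det ≠ 0) ∧
      (∀ c, (s c).card ≤ 3) ∧ ∀ c, ∀ j ∉ s c, (A j - N c).det = 0

lemma HasTransversalDesign.of_ringEquiv {K : Type*} [Field K] (h : HasTransversalDesign K)
    (e : K ≃+* F) : HasTransversalDesign F := by
  obtain ⟨A, N, k, s, hA, hk, hs, hN⟩ := h
  have hdet : ∀ P Q : Matrix (Fin 2) (Fin 2) K, (P.map e - Q.map e).det = e (P - Q).det := by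
    intro P Q
    simp only [det_fin_two, Matrix.sub_apply, Matrix.map_apply, map_sub, map_mul]
  refine ⟨fun i => (A i).map e, fun c => (N c).map e, k, s, fun i j hij => ?_, fun i => ?_, hs,
    fun c j hj => ?_⟩
  · rw [hdet]; exact (map_ne_zero_iff e e.injective).2 (hA i j hij)
  · rw [hdet]; exact (map_ne_zero_iff e e.injective).2 (hk i)
  · rw [hdet, hN c j hj, map_zero]

/-- The `2 × 2` matrix with given rows, in terms of the codes of its entries. -/
def GF8.matrix (a b c d : ℕ) : Matrix (Fin 2) (Fin 2) GF8 :=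
  !![ofCode a, ofCode b; ofCode c, ofCode d]

/-- The `2 × 2` matrix with given rows, in terms of the codes of its entries. -/
def GF9.matrix (a b c d : ℕ) : Matrix (Fin 2) (Fin 2) GF9 :=
  !![ofCode a, ofCode b; ofCode c, ofCode d]

lemma hasTransversalDesign_GF8 : HasTransversalDesign GF8 := by
  refine ⟨![GF8.matrix 0 7 7 2, GF8.matrix 1 6 0 4, GF8.matrix 0 3 1 2, GF8.matrix 5 5 0 0,
    GF8.matrix 1 7 1 7, GF8.matrix 1 5 4 2, GF8.matrix 0 0 3 1, GF8.matrix 1 0 2 0,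
    GF8.matrix 7 2 2 6, GF8.matrix 7 5 3 6],
    ![0, 1, GF8.matrix 5 0 0 4, GF8.matrix 0 7 3 7], ![0, 0, 0, 1, 1, 1, 2, 2, 3, 3],
    ![{0, 1, 2}, {3, 4, 5}, {5, 6, 7}, {2, 8, 9}], ?_, ?_, by decide, ?_⟩ <;>
  · simp only [det_fin_two]
    decide +kernel

lemma hasTransversalDesign_GF9 : HasTransversalDesign GF9 := by
  refine ⟨![GF9.matrix 0 5 4 0, GF9.matrix 8 5 3 7, GF9.matrix 0 6 0 3, GF9.matrix 0 0 8 3,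
    GF9.matrix 6 0 6 0, GF9.matrix 8 6 6 5, GF9.matrix 3 2 8 7, GF9.matrix 5 6 6 8,
    GF9.matrix 5 7 4 8, GF9.matrix 5 5 8 8],
    ![0, 1, GF9.matrix 6 0 0 3, GF9.matrix 8 5 6 0], ![0, 0, 1, 1, 1, 2, 2, 3, 3, 3],
    ![{0, 1}, {2, 3, 4}, {5, 6}, {7, 8, 9}], ?_, ?_, by decide, ?_⟩ <;>
  · simp only [det_fin_two]
    decide +kernel

lemma hasTransversalDesign (hF : Nat.card F = 8 ∨ Nat.card F = 9) : HasTransversalDesign F := by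
  rcases nonempty_ringEquiv_GF8_or_GF9 hF with ⟨⟨e⟩⟩ | ⟨⟨e⟩⟩
  · exact hasTransversalDesign_GF8.of_ringEquiv e.symm
  · exact hasTransversalDesign_GF9.of_ringEquiv e.symm

variable {n r ℓ : ℕ}

lemma HasInvertibleBlocks.rank_eq {H : Matrix (Fin r × Fin ℓ) (Fin n × Fin ℓ) F}
    (h : HasInvertibleBlocks H) (hrn : r ≤ n) : H.rank = r * ℓ := by
  refine le_antisymm (by simpa using H.rank_le_card_height) ?_
  have hr := Matrix.rank_of_isUnit _ (h (Fin.castLEEmb hrn))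
  have he : H.submatrix id (fun p : Fin r × Fin ℓ => (Fin.castLEEmb hrn p.1, p.2)) =
      H * (1 : Matrix (Fin n × Fin ℓ) (Fin n × Fin ℓ) F).submatrix id
        (fun p : Fin r × Fin ℓ => (Fin.castLEEmb hrn p.1, p.2)) := by
    ext a b
    simp [Matrix.mul_apply, Matrix.one_apply]
  rw [he] at hr
  have := Matrix.rank_mul_le_left H ((1 : Matrix (Fin n × Fin ℓ) (Fin n × Fin ℓ) F).submatrix id
        (fun p : Fin r × Fin ℓ => (Fin.castLEEmb hrn p.1, p.2)))
  rw [hr] at this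
  simpa using this

/-- A block matrix with invertible square block submatrices is the parity-check matrix of an MDS
array code. -/
lemma HasInvertibleBlocks.exists_isMDSArrayCode {H : Matrix (Fin r × Fin ℓ) (Fin n × Fin ℓ) F}
    (h : HasInvertibleBlocks H) (hrn : r ≤ n) :
    ∃ C : Submodule F (Fin n → Fin ℓ → F), IsMDSArrayCode r C ∧ IsParityCheck H C := by
  let φ : (Fin n → Fin ℓ → F) →ₗ[F] (Fin r × Fin ℓ → F) :=
    H.mulVecLin ∘ₗ (LinearEquiv.curry F F (Fin n) (Fin ℓ)).symm.toLinearMap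
  have hφ : ∀ c, φ c = ∑ j, block H j *ᵥ c j := fun c => (sum_block_mulVec H c).symm
  have hpc : IsParityCheck H (LinearMap.ker φ) :=
    ⟨h.rank_eq hrn, fun c => by rw [LinearMap.mem_ker, hφ]⟩
  refine ⟨LinearMap.ker φ, ⟨?_, H, hpc, h⟩, hpc⟩
  have h1 := LinearMap.finrank_range_add_finrank_ker φ
  rw [LinearMap.range_comp_of_range_eq_top _ (LinearEquiv.range _)] at h1
  have h2 : Module.finrank F (LinearMap.range H.mulVecLin) = r * ℓ := h.rank_eq hrn
  rw [h2] at h1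
  simp only [Module.finrank_pi_fintype, Module.finrank_self, Finset.sum_const, Finset.card_univ,
    Fintype.card_fin, smul_eq_mul, mul_one] at h1
  rw [Nat.sub_mul]
  omega

/-- The block matrix with blocks `[1; A j]`, whose column spaces are the graphs of the `A j`. -/
def graphParityCheck (A : Fin n → Matrix (Fin 2) (Fin 2) F) :
    Matrix (Fin 2 × Fin 2) (Fin n × Fin 2) F :=
  of fun p c => if p.1 = 0 then (1 : Matrix (Fin 2) (Fin 2) F) p.2 c.2 else A c.1 p.2 c.2

/-- The matrix `[-N, 1]`, whose kernel is the graph of `N`. -/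
def graphRepair (N : Matrix (Fin 2) (Fin 2) F) : Matrix (Fin 2) (Fin 2 × Fin 2) F :=
  of fun s p => if p.1 = 0 then -N s p.2 else (1 : Matrix (Fin 2) (Fin 2) F) s p.2

lemma graphRepair_mul_block (A : Fin n → Matrix (Fin 2) (Fin 2) F) (N : Matrix (Fin 2) (Fin 2) F)
    (j : Fin n) : graphRepair N * block (graphParityCheck A) j = A j - N := by
  ext s t
  fin_cases s <;> fin_cases t <;>
  simp [graphRepair, graphParityCheck, block, Matrix.mul_apply, Fintype.sum_prod_type,
    Matrix.one_apply, sub_eq_neg_add]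

lemma hasInvertibleBlocks_graphParityCheck {A : Fin n → Matrix (Fin 2) (Fin 2) F}
    (hA : ∀ i j, i ≠ j → (A i - A j).det ≠ 0) : HasInvertibleBlocks (graphParityCheck A) := by
  intro e
  rw [← Matrix.mulVec_injective_iff_isUnit]
  change Function.Injective (Matrix.mulVecLin _)
  rw [injective_iff_map_eq_zero]
  intro w hw
  have hsum : ∀ t, w (0, t) + w (1, t) = 0 := by
    intro t
    have := congrFun hw (0, t)
    simpa [graphParityCheck, Matrix.mulVec, dotProduct, Fintype.sum_prod_type,
      Matrix.one_apply] using this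
  have hw0 : (fun t => w (0, t)) = 0 := by
    by_contra h0
    refine hA (e 0) (e 1) (by simp) (Matrix.exists_mulVec_eq_zero_iff.1 ⟨_, h0, ?_⟩)
    ext t
    have := congrFun hw (1, t)
    simp only [graphParityCheck, Matrix.mulVecLin_apply, Matrix.mulVec, dotProduct,
      Fintype.sum_prod_type, Fin.sum_univ_two, submatrix_apply, of_apply, id, one_ne_zero, if_false,
      Pi.zero_apply, Matrix.sub_apply] at this ⊢
    linear_combination this - A (e 1) t 0 * hsum 0 - A (e 1) t 1 * hsum 1
  ext ⟨i, t⟩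
  have h0 : w (0, t) = 0 := congrFun hw0 t
  fin_cases i
  · exact h0
  · have := hsum t
    rwa [h0, zero_add] at this

lemma rank_le_one_of_det_eq_zero {P : Matrix (Fin 2) (Fin 2) F} (h : P.det = 0) : P.rank ≤ 1 := by
  by_contra! h2
  have h3 := P.rank_le_card_height
  rw [Fintype.card_fin] at h3
  have hs : Function.Surjective P.mulVecLin := by
    rw [← LinearMap.range_eq_top]
    refine Submodule.eq_top_of_finrank_eq ?_
    rw [Module.finrank_fintype_fun_eq_card, Fintype.card_fin]
    exact le_antisymm h3 h2
  exact (((Matrix.isUnit_iff_isUnit_det P).1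
    (Matrix.mulVec_surjective_iff_isUnit.1 hs)).ne_zero) h

theorem exists_worstBandwidth_le_eleven (hF : Nat.card F = 8 ∨ Nat.card F = 9) :
    ∃ C : Submodule F (Fin 10 → Fin 2 → F), IsMDSArrayCode 2 C ∧ worstBandwidth 2 C ≤ 11 := by
  obtain ⟨A, N, k, s, hA, hk, hs, hN⟩ := hasTransversalDesign hF
  have hH := hasInvertibleBlocks_graphParityCheck hA
  obtain ⟨C, hC, hpc⟩ := hH.exists_isMDSArrayCode (by norm_num)
  refine ⟨C, hC, Finset.sup_le fun i _ => ?_⟩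
  have hrep : IsRepairMatrix (graphParityCheck A) i (graphRepair (N (k i))) := by
    rw [IsRepairMatrix, graphRepair_mul_block, Matrix.isUnit_iff_isUnit_det]
    exact (hk i).isUnit
  rw [nodeBandwidth_eq hpc]
  refine le_trans (Nat.sInf_le ⟨_, hrep, rfl⟩) ?_
  have hi : i ∈ s (k i) := by
    by_contra h
    exact hk i (hN _ i h)
  have hle : bandwidth (graphParityCheck A) i (graphRepair (N (k i))) ≤
      ∑ j ∈ Finset.univ.erase i, (1 + if j ∈ s (k i) then 1 else 0) := by
    refine Finset.sum_le_sum fun j _ => ?_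
    rw [graphRepair_mul_block]
    split_ifs with hj
    · simpa using (A j - N (k i)).rank_le_card_height
    · exact rank_le_one_of_det_eq_zero (hN _ j hj)
  refine hle.trans ?_
  rw [Finset.sum_add_distrib, ← Finset.sum_filter, Finset.sum_const, Finset.sum_const,
    Finset.filter_mem_eq_inter, Finset.erase_inter, Finset.univ_inter,
    Finset.card_erase_of_mem hi, Finset.card_erase_of_mem (Finset.mem_univ i), Finset.card_univ,
    Fintype.card_fin]
  have := hs (k i)
  simp only [smul_eq_mul]
  omega

end UpperBound
end MDSArray

theorem mainTheorem12 (F : Type*) [Field F] (hF : Nat.card F = 8 ∨ Nat.card F = 9) :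
    MDSArray.optBandwidth F 10 2 2 = 11 ∧
      ∀ C : Submodule F (Fin 10 → Fin 2 → F),
        MDSArray.IsMDSArrayCode 2 C → MDSArray.worstBandwidth 2 C ≠ 10 := by
  have hlow : ∀ C : Submodule F (Fin 10 → Fin 2 → F), MDSArray.IsMDSArrayCode 2 C →
      11 ≤ MDSArray.worstBandwidth 2 C := fun C hC => MDSArray.eleven_le_worstBandwidth hF hC
  refine ⟨?_, fun C hC h => by have := hlow C hC; omega⟩
  obtain ⟨C, hC, hle⟩ := MDSArray.exists_worstBandwidth_le_eleven hF
  refine le_antisymm (le_trans (Nat.sInf_le ⟨C, hC, rfl⟩) hle) (le_csInf ⟨_, C, hC, rfl⟩ ?_)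
  rintro _ ⟨C', hC', rfl⟩
  exact hlow C' hC'
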